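/- \textbf{Theorem 1.} Let $U\subseteq\mathbb R^2$ be open, let $P_0,\dots,P_7:U\to\mathbb R$ be smooth functions of $(x,y)$, and consider the fourth-order ordinary differential equation $$y''''+P_7y'^7-P_6y'^6+P_5y'^5-P_4y'^4+P_3y'^3-P_2y'^2+P_1y'-P_0=0. \tag{A}$$ Define (real cube root; subscripts $x,y$ are partial derivatives) $$c=(P_7/15)^{1/3},\qquad g=\frac{P_6}{35c^2}-\frac{2c_y}{7c},$$ $$h=\frac{P_5}{27c^2}-\frac{26g^2}{27c}+\frac{c_x}{3c}-\frac{gc_y}{3c^2}-\frac{8g_y}{27c}-\frac{c_{yy}}{27c^2},$$ $$d=\frac{P_4}{21c^2}-\frac{38gh}{21c}-\frac{2g^3}{7c^2}+\frac{8gc_x}{21c^2}-\frac{8hc_y}{21c^2}+\frac{g_x}{3c}-\frac{gg_y}{3c^2}-\frac{2h_y}{7c}+\frac{2c_{xy}}{21c^2}-\frac{g_{yy}}{21c^2}.$$ Assume that on $U$: $c\neq0$; the four differential constraints $$\begin{aligned} P_3&=28cdg+13ch^2+12g^2h-7hc_x+7dc_y-6gg_x+6hg_y-5ch_x+5gh_y+4cd_y+c_{xx}-2g_{xy}+h_{yy},\\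 P_2&=18chd+8g^2d+7gh^2-6dc_x-5hg_x+5dg_y-4gh_x+4hh_y-3cd_x+3gd_y+g_{xx}-2h_{xy}+d_{yy},\\ P_1&=6cd^2+8ghd+h^3-4dg_x-3hh_x+3dh_y-2gd_x+2hd_y+h_{xx}-2d_{xy},\\ P_0&=2gd^2+h^2d-2dh_x-hd_x+dd_y+d_{xx} \end{aligned}$$ hold; and the Lie--Tresse criteria hold: $$\begin{aligned} 3(ch)_x+3dc_y+6cd_y-2gg_x-gh_y-3c_{xx}-2g_{xy}-h_{yy}&=0,\\ 3(dg)_y+3cd_x+6dc_x-2hh_y-hg_x-3d_{yy}-2h_{xy}-g_{xx}&=0. \end{aligned}$$ Then the following hold. (1) Equation (A) is conditionally linearizable, with root equation $$y''+cy'^3-gy'^2+hy'-d=0. \tag{B}$$ That is: (A) is obtained from (B) by differentiating twice with respect to $x$ and eliminating $y''$ by means of (B) after each differentiation; every ($C^2$) solution of (B) is $C^4$ and solves (A); and near every point of $U$ there is a smooth invertible point transformation $(x,y)\mapsto(X,Y)$ that carries (B) to the linear equation $d^2Y/dX^2=0$. (2) Over no nonempty open subset of $U$ is the left-hand side of (A)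 the total derivative $d\Phi/dx$ of a differentiable function $\Phi(x,y,y',y'',y''')$. (3) Near every point of $U$ there are smooth functions $a,b,e,f$ with $h=a-2e$, $g=f-2b$, and a smooth nondegenerate metric $p\,dx^2+2q\,dx\,dy+r\,dy^2$, such that $\Gamma^1_{11}=-a$, $\Gamma^1_{12}=-b$, $\Gamma^1_{22}=-c$, $\Gamma^2_{11}=-d$, $\Gamma^2_{12}=-e$, $\Gamma^2_{22}=-f$ are the Christoffel symbols of this metric and the metric is flat. -/

import Mathlib

open scoped ContDiff

noncomputable section

namespace CondLin

/-- Partial derivative `∂f/∂x` of a function of `(x, y)`. -/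
def dx (f : ℝ × ℝ → ℝ) (z : ℝ × ℝ) : ℝ := fderiv ℝ f z (1, 0)

/-- Partial derivative `∂f/∂y` of a function of `(x, y)`. -/
def dy (f : ℝ × ℝ → ℝ) (z : ℝ × ℝ) : ℝ := fderiv ℝ f z (0, 1)

/-- Total derivative `F_x + p F_y + q F_p` of a function `F (x, y) p` of `x`, `y` and `p = y'`,
where `q` stands for `y''`. -/
def totalDeriv (F : ℝ × ℝ → ℝ → ℝ) (z : ℝ × ℝ) (p q : ℝ) : ℝ :=
  dx (fun w => F w p) z + p * dy (fun w => F w p) z + q * deriv (F z) p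

/-- The total derivative of `F (x, y) y'` after replacing `y''` by `Q (x, y) y'`. -/
def totalDerivAlong (Q F : ℝ × ℝ → ℝ → ℝ) (z : ℝ × ℝ) (p : ℝ) : ℝ :=
  totalDeriv F z p (Q z p)

/-- The real cube root, also for negative arguments. -/
def cbrt (t : ℝ) : ℝ := Real.sign t * |t| ^ (1 / 3 : ℝ)

/-! ### The fourth-order equation and the identification of the root coefficients -/

/-- The polynomial `P₇ p⁷ - P₆ p⁶ + P₅ p⁵ - P₄ p⁴ + P₃ p³ - P₂ p² + P₁ p - P₀`; the fourth-order
equation is `y'''' + septic P (x, y) y' = 0`. -/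
def septic (P : Fin 8 → ℝ × ℝ → ℝ) (z : ℝ × ℝ) (p : ℝ) : ℝ :=
  P 7 z * p ^ 7 - P 6 z * p ^ 6 + P 5 z * p ^ 5 - P 4 z * p ^ 4
    + P 3 z * p ^ 3 - P 2 z * p ^ 2 + P 1 z * p - P 0 z

def coeffC (P : Fin 8 → ℝ × ℝ → ℝ) (z : ℝ × ℝ) : ℝ := cbrt (P 7 z / 15)

def coeffG (P : Fin 8 → ℝ × ℝ → ℝ) (z : ℝ × ℝ) : ℝ :=
  let c := coeffC P
  P 6 z / (35 * c z ^ 2) - 2 * dy c z / (7 * c z)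

def coeffH (P : Fin 8 → ℝ × ℝ → ℝ) (z : ℝ × ℝ) : ℝ :=
  let c := coeffC P
  let g := coeffG P
  P 5 z / (27 * c z ^ 2) - 26 * g z ^ 2 / (27 * c z) + dx c z / (3 * c z)
    - g z * dy c z / (3 * c z ^ 2) - 8 * dy g z / (27 * c z) - dy (dy c) z / (27 * c z ^ 2)

def coeffD (P : Fin 8 → ℝ × ℝ → ℝ) (z : ℝ × ℝ) : ℝ :=
  let c := coeffC P
  let g := coeffG P
  let h := coeffH P
  P 4 z / (21 * c z ^ 2) - 38 * g z * h z / (21 * c z) - 2 * g z ^ 3 / (7 * c z ^ 2)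
    + 8 * g z * dx c z / (21 * c z ^ 2) - 8 * h z * dy c z / (21 * c z ^ 2)
    + dx g z / (3 * c z) - g z * dy g z / (3 * c z ^ 2) - 2 * dy h z / (7 * c z)
    + 2 * dx (dy c) z / (21 * c z ^ 2) - dy (dy g) z / (21 * c z ^ 2)

/-- The differential constraints on `P₃`, `P₂`, `P₁`, `P₀` at the point `z`. -/
def Constraints (P : Fin 8 → ℝ × ℝ → ℝ) (c g h d : ℝ × ℝ → ℝ) (z : ℝ × ℝ) : Prop :=
  P 3 z = 28 * c z * d z * g z + 13 * c z * h z ^ 2 + 12 * g z ^ 2 * h z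
      - 7 * h z * dx c z + 7 * d z * dy c z - 6 * g z * dx g z + 6 * h z * dy g z
      - 5 * c z * dx h z + 5 * g z * dy h z + 4 * c z * dy d z
      + dx (dx c) z - 2 * dx (dy g) z + dy (dy h) z ∧
  P 2 z = 18 * c z * h z * d z + 8 * g z ^ 2 * d z + 7 * g z * h z ^ 2
      - 6 * d z * dx c z - 5 * h z * dx g z + 5 * d z * dy g z - 4 * g z * dx h z
      + 4 * h z * dy h z - 3 * c z * dx d z + 3 * g z * dy d z
      + dx (dx g) z - 2 * dx (dy h) z + dy (dy d) z ∧
  P 1 z = 6 * c z * d z ^ 2 + 8 * g z * h z * d z + h z ^ 3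
      - 4 * d z * dx g z - 3 * h z * dx h z + 3 * d z * dy h z - 2 * g z * dx d z
      + 2 * h z * dy d z + dx (dx h) z - 2 * dx (dy d) z ∧
  P 0 z = 2 * g z * d z ^ 2 + h z ^ 2 * d z - 2 * d z * dx h z - h z * dx d z
      + d z * dy d z + dx (dx d) z

/-- The Lie–Tresse conditions at the point `z` for the equation
`y'' + c y'³ - g y'² + h y' - d = 0`. -/
def LieTresse (c g h d : ℝ × ℝ → ℝ) (z : ℝ × ℝ) : Prop :=
  3 * dx (fun w => c w * h w) z + 3 * d z * dy c z + 6 * c z * dy d z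
      - 2 * g z * dx g z - g z * dy h z
      - 3 * dx (dx c) z - 2 * dx (dy g) z - dy (dy h) z = 0 ∧
  3 * dy (fun w => d w * g w) z + 3 * c z * dx d z + 6 * d z * dx c z
      - 2 * h z * dy h z - h z * dx g z
      - 3 * dy (dy d) z - 2 * dx (dy h) z - dx (dx g) z = 0

/-! ### Root equation, linearizability, conditional linearizability -/

/-- Right-hand side of the root equation `y'' = -c y'³ + g y'² - h y' + d`. -/
def rootRHS (c g h d : ℝ × ℝ → ℝ) (z : ℝ × ℝ) (p : ℝ) : ℝ :=
  -(c z) * p ^ 3 + g z * p ^ 2 - h z * p + d z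

/-- `y` is a classical solution of order `n` on the open set `I`, with graph in `U`, of
`y⁽ⁿ⁾ = F (x, y) y'`. -/
def IsSolution (n : ℕ) (U : Set (ℝ × ℝ)) (F : ℝ × ℝ → ℝ → ℝ) (I : Set ℝ) (y : ℝ → ℝ) : Prop :=
  IsOpen I ∧ ContDiffOn ℝ n y I ∧
    ∀ x ∈ I, (x, y x) ∈ U ∧ iteratedDeriv n y x = F (x, y x) (deriv y x)

/-- `dX/dx` along a curve of slope `p`. -/
def slopeDeriv (X : ℝ × ℝ → ℝ) (z : ℝ × ℝ) (p : ℝ) : ℝ := dx X z + p * dy X z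

/-- The transformed first derivative `dY/dX` as a function of `x`, `y`, `y'`. -/
def newFirst (X Y : ℝ × ℝ → ℝ) (z : ℝ × ℝ) (p : ℝ) : ℝ := slopeDeriv Y z p / slopeDeriv X z p

/-- The transformed second derivative `d²Y/dX²` as a function of `x`, `y`, `y'`, `y''`. -/
def newSecond (X Y : ℝ × ℝ → ℝ) (z : ℝ × ℝ) (p q : ℝ) : ℝ :=
  totalDeriv (newFirst X Y) z p q / slopeDeriv X z p

/-- `y'' = Q (x, y) y'` is linearizable near `z₀` by an invertible point transformation
`(x, y) ↦ (X, Y)`: in the new variables it is the linear equation `d²Y/dX² = 0` (to which every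
linear second-order equation is locally equivalent). -/
def LinearizableAt (U : Set (ℝ × ℝ)) (Q : ℝ × ℝ → ℝ → ℝ) (z₀ : ℝ × ℝ) : Prop :=
  ∃ (V : Set (ℝ × ℝ)) (X Y : ℝ × ℝ → ℝ),
    IsOpen V ∧ z₀ ∈ V ∧ V ⊆ U ∧ ContDiffOn ℝ ∞ X V ∧ ContDiffOn ℝ ∞ Y V ∧
    Set.InjOn (fun z => (X z, Y z)) V ∧
    (∀ z ∈ V, dx X z * dy Y z - dy X z * dx Y z ≠ 0) ∧
    ∀ z ∈ V, ∀ p q : ℝ, slopeDeriv X z p ≠ 0 → (q = Q z p ↔ newSecond X Y z p q = 0)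

/-- The equation `y'''' = F (x, y) y'` is linearizable on `U` conditionally on the root equation
`y'' = Q (x, y) y'`: it is obtained from the root equation by differentiating twice and
eliminating `y''` after each differentiation, every solution of the root equation solves it, and
the root equation is linearizable near every point. -/
def ConditionallyLinearizable (U : Set (ℝ × ℝ)) (F Q : ℝ × ℝ → ℝ → ℝ) : Prop :=
  (∀ z ∈ U, ∀ p : ℝ, F z p = totalDerivAlong Q (totalDerivAlong Q Q) z p) ∧
  (∀ (I : Set ℝ) (y : ℝ → ℝ), IsSolution 2 U Q I y → IsSolution 4 U F I y) ∧
  ∀ z ∈ U, LinearizableAt U Q z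

/-- `y'''' + G (x, y) y'` is a total derivative over `V`: it equals `dΦ/dx` for some function
`Φ (x, y, y', y'', y''')`, identically in `x, y, y', y'', y''', y''''`. -/
def IsTotalDerivativeOn (V : Set (ℝ × ℝ)) (G : ℝ × ℝ → ℝ → ℝ) : Prop :=
  ∃ Φ : ℝ × ℝ × ℝ × ℝ × ℝ → ℝ,
    DifferentiableOn ℝ Φ {w | (w.1, w.2.1) ∈ V} ∧
    ∀ x y p q r s : ℝ, (x, y) ∈ V →
      fderiv ℝ Φ (x, y, p, q, r) (1, p, q, r, s) = s + G (x, y) p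

/-! ### The associated flat metric -/

/-- Vanishing at `z` of the curvature of the connection with `Γ¹₁₁ = -a`, `Γ¹₁₂ = -b`,
`Γ¹₂₂ = -c`, `Γ²₁₁ = -d`, `Γ²₁₂ = -e`, `Γ²₂₂ = -f`. -/
def FlatChristoffel (a b c d e f : ℝ × ℝ → ℝ) (z : ℝ × ℝ) : Prop :=
  dy a z - dx b z + b z * e z - c z * d z = 0 ∧
  dy b z - dx c z + (a z * c z - b z ^ 2) + (b z * f z - c z * e z) = 0 ∧
  dy d z - dx e z - (a z * e z - b z * d z) - (d z * f z - e z ^ 2) = 0 ∧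
  dx (fun w => b w + f w) z = dy (fun w => a w + e w) z

/-- At `z`, the connection above is the Levi-Civita connection of the metric
`p dx² + 2 q dx dy + r dy²`. -/
def MetricCompatible (a b c d e f p q r : ℝ × ℝ → ℝ) (z : ℝ × ℝ) : Prop :=
  p z * r z - q z ^ 2 ≠ 0 ∧
  dx p z = -2 * (a z * p z + d z * q z) ∧
  dx q z = -(b z * p z) - (a z + e z) * q z - d z * r z ∧
  dx r z = -2 * (b z * q z + e z * r z) ∧
  dy p z = -2 * (b z * p z + e z * q z) ∧
  dy q z = -(c z * p z) - (b z + f z) * q z - e z * r z ∧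
  dy r z = -2 * (c z * q z + f z * r z)

/-- Near `z₀` the coefficients `c, g, h, d` come, through `h = a - 2e` and `g = f - 2b`, from the
Christoffel symbols of a flat nondegenerate metric. -/
def HasFlatMetricAt (U : Set (ℝ × ℝ)) (c g h d : ℝ × ℝ → ℝ) (z₀ : ℝ × ℝ) : Prop :=
  ∃ (V : Set (ℝ × ℝ)) (a b e f p q r : ℝ × ℝ → ℝ),
    IsOpen V ∧ z₀ ∈ V ∧ V ⊆ U ∧
    ContDiffOn ℝ ∞ a V ∧ ContDiffOn ℝ ∞ b V ∧ ContDiffOn ℝ ∞ e V ∧ ContDiffOn ℝ ∞ f V ∧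
    ContDiffOn ℝ ∞ p V ∧ ContDiffOn ℝ ∞ q V ∧ ContDiffOn ℝ ∞ r V ∧
    ∀ z ∈ V, h z = a z - 2 * e z ∧ g z = f z - 2 * b z ∧
      FlatChristoffel a b c d e f z ∧ MetricCompatible a b c d e f p q r z

end CondLin

end

/-!
The ratios `w / w₀` of solutions of a suitable linear system, expressing `w_xx`, `w_xy`, `w_yy`
through `w`, `w_x`, `w_y`, linearize the root equation. For such a system a solution with a given
1-jet at a point exists as soon as the induced connection on triples `(w, w_x, w_y)` is flat, and
its curvature is exactly the pair of Lie–Tresse expressions. Two such ratios `X`, `Y` are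
coordinates in which the solutions of the root equation are straight lines, and `dX² + dY²` is the
flat metric. A total derivative, on the other hand, forces `Φ` to be affine in `y'''` with the
remaining part depending on `x`, `y` only, which makes the left-hand side of the fourth-order
equation affine in `y'`.
-/

open scoped ContDiff

noncomputable section

namespace CondLin

open Set Metric Filter Topology
open scoped BoundedContinuousFunction

section Derivatives

variable {E : Type*} [NormedAddCommGroup E] [NormedSpace ℝ E]

theorem hasDerivAt_fst_line {F : ℝ × ℝ → E} {x y : ℝ} (hF : DifferentiableAt ℝ F (x, y)) :
    HasDerivAt (fun t => F (t, y)) (fderiv ℝ F (x, y) (1, 0)) x :=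
  hF.hasFDerivAt.comp_hasDerivAt x ((hasDerivAt_id x).prodMk (hasDerivAt_const x y))

theorem hasDerivAt_snd_line {F : ℝ × ℝ → E} {x y : ℝ} (hF : DifferentiableAt ℝ F (x, y)) :
    HasDerivAt (fun t => F (x, t)) (fderiv ℝ F (x, y) (0, 1)) y :=
  hF.hasFDerivAt.comp_hasDerivAt y ((hasDerivAt_const y x).prodMk (hasDerivAt_id y))

variable {G : Type*} [NormedAddCommGroup G] [NormedSpace ℝ G] {F : G → E} {U : Set G}

theorem differentiableAt_of_contDiffOn (hU : IsOpen U) (hF : ContDiffOn ℝ ∞ F U) {z : G}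
    (hz : z ∈ U) : DifferentiableAt ℝ F z :=
  (hF.contDiffAt (hU.mem_nhds hz)).differentiableAt (by simp)

theorem contDiffAt_two_of_contDiffOn (hU : IsOpen U) (hF : ContDiffOn ℝ ∞ F U) {z : G}
    (hz : z ∈ U) : ContDiffAt ℝ 2 F z :=
  contDiffAt_infty.1 (hF.contDiffAt (hU.mem_nhds hz)) 2

theorem differentiableAt_div {f g : G → ℝ} {z : G} (hf : DifferentiableAt ℝ f z)
    (hg : DifferentiableAt ℝ g z) (h : g z ≠ 0) : DifferentiableAt ℝ (fun w => f w / g w) z := by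
  simp only [div_eq_mul_inv]
  exact hf.fun_mul (hg.fun_inv h)

theorem contDiffOn_fderiv_apply_const (hU : IsOpen U) (hF : ContDiffOn ℝ ∞ F U) (w : G) :
    ContDiffOn ℝ ∞ (fun z => fderiv ℝ F z w) U :=
  ((contDiffOn_infty_iff_fderiv_of_isOpen hU).1 hF).2.clm_apply contDiffOn_const

end Derivatives

/-! ### Linear differential equations -/

section LinearODE

variable {E : Type*} [NormedAddCommGroup E] [NormedSpace ℝ E]

theorem norm_intervalIntegral_le_of_support_subset {f : ℝ → E} {t₀ ρ C : ℝ} (hρ : 0 ≤ ρ)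
    (hf : ∀ s, ‖f s‖ ≤ C) (hsupp : Function.support f ⊆ closedBall t₀ ρ) (t : ℝ) :
    ‖∫ s in t₀..t, f s‖ ≤ C * (2 * ρ) := by
  rw [intervalIntegral.norm_intervalIntegral_eq,
    ← MeasureTheory.integral_indicator measurableSet_uIoc,
    ← MeasureTheory.setIntegral_eq_integral_of_forall_compl_eq_zero (s := closedBall t₀ ρ)]
  · refine (MeasureTheory.norm_setIntegral_le_of_norm_le_const
      (isCompact_closedBall t₀ ρ).measure_lt_top
      fun s _ => (norm_indicator_le_norm_self f s).trans (hf s)).trans ?_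
    rw [MeasureTheory.Measure.real, Real.volume_closedBall, ENNReal.toReal_ofReal (by positivity)]
  · intro s hs
    exact indicator_apply_eq_zero.2 fun _ => Function.notMem_support.1 fun h => hs (hsupp h)

theorem exists_linear_ode_solution_of_small_support [CompleteSpace E] {P : Type*}
    [TopologicalSpace P] {L : P × ℝ → E →L[ℝ] E} {t₀ ρ M : ℝ} (hL : Continuous L) (hρ : 0 ≤ ρ)
    (hM : ∀ z, ‖L z‖ ≤ M) (hsupp : ∀ p, Function.support (fun t => L (p, t)) ⊆ closedBall t₀ ρ)
    (hMρ : M * (2 * ρ) < 1) (φ : P →ᵇ E) :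
    ∃ ψ : P × ℝ →ᵇ E, (∀ p, ψ (p, t₀) = φ p) ∧
      ∀ p t, HasDerivAt (fun t => ψ (p, t)) (L (p, t) (ψ (p, t))) t := by
  rcases isEmpty_or_nonempty P with hP | ⟨⟨p₀⟩⟩
  · exact ⟨0, hP.elim, hP.elim⟩
  have hM0 : 0 ≤ M := (norm_nonneg _).trans (hM (p₀, 0))
  have hcont (ψ : P × ℝ →ᵇ E) : Continuous fun z => L z (ψ z) := hL.clm_apply ψ.continuous
  let I (ψ : P × ℝ →ᵇ E) (z : P × ℝ) : E := ∫ s in t₀..z.2, L (z.1, s) (ψ (z.1, s))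
  have hI (ψ : P × ℝ →ᵇ E) : Continuous (I ψ) :=
    intervalIntegral.continuous_parametric_intervalIntegral_of_continuous
      (f := fun (z : P × ℝ) s => L (z.1, s) (ψ (z.1, s)))
      ((hcont ψ).comp (by fun_prop)) continuous_snd
  have hbound (ψ : P × ℝ →ᵇ E) (z : P × ℝ) : ‖I ψ z‖ ≤ M * (2 * ρ) * ‖ψ‖ := by
    rw [mul_right_comm]
    refine norm_intervalIntegral_le_of_support_subset hρ
      (fun s => (L _).le_of_opNorm_le_of_le (hM _) (ψ.norm_coe_le_norm _)) (fun s hs => ?_) _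
    exact hsupp z.1 fun h => hs (by simp_all)
  let T (ψ : P × ℝ →ᵇ E) : P × ℝ →ᵇ E :=
    φ.compContinuous ⟨Prod.fst, continuous_fst⟩ +
      BoundedContinuousFunction.ofNormedAddCommGroup (I ψ) (hI ψ) _ (hbound ψ)
  have hT (ψ : P × ℝ →ᵇ E) (z : P × ℝ) : T ψ z = φ z.1 + I ψ z := rfl
  have hcontr : ContractingWith ⟨M * (2 * ρ), by positivity⟩ T := by
    refine ⟨hMρ, LipschitzWith.of_dist_le_mul fun ψ χ => ?_⟩
    refine (BoundedContinuousFunction.dist_le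
      (mul_nonneg (NNReal.coe_nonneg _) dist_nonneg)).2 fun z => ?_
    have hsub : I ψ z - I χ z = I (ψ - χ) z := by
      simp only [I, BoundedContinuousFunction.sub_apply, map_sub]
      refine (intervalIntegral.integral_sub ?_ ?_).symm
      exacts [((hcont ψ).comp (by fun_prop)).intervalIntegrable _ _,
        ((hcont χ).comp (by fun_prop)).intervalIntegrable _ _]
    rw [dist_eq_norm, hT, hT, add_sub_add_left_eq_sub, hsub, dist_eq_norm]
    exact hbound _ z
  obtain ⟨ψ, hψ⟩ : ∃ ψ, T ψ = ψ := ⟨_, hcontr.fixedPoint_isFixedPt⟩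
  have hψI (p : P) (t : ℝ) : ψ (p, t) = φ p + I ψ (p, t) := by
    rw [← hT ψ (p, t), hψ]
  refine ⟨ψ, fun p => by simp [hψI, I], fun p t => ?_⟩
  have hder := ((hcont ψ).comp (Continuous.prodMk_right p)).integral_hasStrictDerivAt t₀ t
  exact (hder.hasDerivAt.const_add (φ p)).congr_of_eventuallyEq (.of_forall (hψI p))

end LinearODE

/-! ### Flat connections on the plane -/

section Frobenius

variable {E : Type*} [NormedAddCommGroup E] [NormedSpace ℝ E]

theorem mk_mem_closedBall_of_mem_uIcc {x₀ y₀ r x y s : ℝ}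
    (hxy : (x, y) ∈ closedBall (x₀, y₀) r) (hs : s ∈ uIcc x₀ x) :
    (s, y) ∈ closedBall (x₀, y₀) r := by
  rw [← closedBall_prod_same] at hxy ⊢
  have hr : 0 ≤ r := nonneg_of_mem_closedBall hxy.1
  exact ⟨(convex_closedBall x₀ r).ordConnected.uIcc_subset (mem_closedBall_self hr) hxy.1 hs,
    hxy.2⟩

theorem norm_apply_sub_intervalIntegral_le {B C : ℝ × ℝ → E →L[ℝ] E} {δ : ℝ × ℝ → E}
    {x₀ y₀ r M N K x y : ℝ} (hB : ∀ z ∈ closedBall (x₀, y₀) r, ‖B z‖ ≤ M)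
    (hC : ∀ z ∈ closedBall (x₀, y₀) r, ‖C z‖ ≤ N) (hδ : ∀ z ∈ closedBall (x₀, y₀) r, ‖δ z‖ ≤ K)
    (hxy : (x, y) ∈ closedBall (x₀, y₀) r) :
    ‖B (x, y) (δ (x, y)) - ∫ s in x₀..x, C (s, y) (δ (s, y))‖ ≤ (M + r * N) * K := by
  have hBδ := (B (x, y)).le_of_opNorm_le_of_le (hB _ hxy) (hδ _ hxy)
  have hCδ : ‖∫ s in x₀..x, C (s, y) (δ (s, y))‖ ≤ N * K * |x - x₀| :=
    intervalIntegral.norm_integral_le_of_norm_le_const fun s hs =>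
      have hsy := mk_mem_closedBall_of_mem_uIcc hxy (uIoc_subset_uIcc hs)
      (C (s, y)).le_of_opNorm_le_of_le (hC _ hsy) (hδ _ hsy)
  have hN : 0 ≤ N := (norm_nonneg _).trans (hC _ hxy)
  have hK : 0 ≤ K := (norm_nonneg _).trans (hδ _ hxy)
  have hx : |x - x₀| ≤ r := (le_max_left _ _).trans hxy
  calc _ ≤ _ := norm_sub_le _ _
    _ ≤ M * K + N * K * r := by gcongr; exact hCδ.trans (by gcongr)
    _ = (M + r * N) * K := by ring

theorem eq_zero_of_hasDerivAt_volterra {B C : ℝ × ℝ → E →L[ℝ] E} {δ : ℝ × ℝ → E}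
    {x₀ y₀ r M N : ℝ} (hδ : Continuous δ) (hB : ∀ z ∈ closedBall (x₀, y₀) r, ‖B z‖ ≤ M)
    (hC : ∀ z ∈ closedBall (x₀, y₀) r, ‖C z‖ ≤ N) (hr : r * (M + r * N) < 1)
    (hδ₀ : ∀ x, δ (x, y₀) = 0)
    (hδ' : ∀ x y, (x, y) ∈ closedBall (x₀, y₀) r → HasDerivAt (fun t => δ (x, t))
      (B (x, y) (δ (x, y)) - ∫ s in x₀..x, C (s, y) (δ (s, y))) y) :
    ∀ z ∈ closedBall (x₀, y₀) r, δ z = 0 := by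
  intro z hz
  have hr₀ : 0 ≤ r := nonneg_of_mem_closedBall hz
  obtain ⟨⟨x, y⟩, hxy, hmax⟩ :=
    (isCompact_closedBall (x₀, y₀) r).exists_isMaxOn ⟨z, hz⟩ hδ.norm.continuousOn
  have hK : ∀ w ∈ closedBall (x₀, y₀) r, ‖δ w‖ ≤ ‖δ (x, y)‖ := fun w hw => hmax hw
  have hx_mem : ∀ t ∈ closedBall y₀ r, (x, t) ∈ closedBall (x₀, y₀) r := by
    rw [← closedBall_prod_same] at hxy ⊢
    exact fun t ht => ⟨hxy.1, ht⟩
  have hy : |y - y₀| ≤ r := (le_max_right _ _).trans hxy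
  have hslope (t : ℝ) (ht : t ∈ closedBall y₀ r) :=
    norm_apply_sub_intervalIntegral_le hB hC hK (hx_mem t ht)
  have hle : ‖δ (x, y)‖ ≤ (M + r * N) * ‖δ (x, y)‖ * r := by
    have hmv := (convex_closedBall y₀ r).norm_image_sub_le_of_norm_hasDerivWithin_le
      (fun t ht => (hδ' x t (hx_mem t ht)).hasDerivWithinAt) hslope (mem_closedBall_self hr₀) hy
    rw [hδ₀, sub_zero] at hmv
    have := (norm_nonneg _).trans (hslope y hy)
    exact hmv.trans (by gcongr; exact hy)
  have hK₀ : ‖δ (x, y)‖ ≤ 0 := by nlinarith [norm_nonneg (δ (x, y))]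
  exact norm_le_zero_iff.1 ((hK z hz).trans hK₀)

theorem hasDerivAt_intervalIntegral_of_continuous {f f' : ℝ × ℝ → E} (hf : Continuous f)
    (hf' : Continuous f') (h : ∀ s t, HasDerivAt (fun t => f (s, t)) (f' (s, t)) t) (a b t : ℝ) :
    HasDerivAt (fun t => ∫ s in a..b, f (s, t)) (∫ s in a..b, f' (s, t)) t := by
  obtain ⟨C, hC⟩ := (isCompact_uIcc.prod (isCompact_closedBall t 1)).exists_bound_of_continuousOn
    (s := uIcc a b ×ˢ closedBall t 1) hf'.continuousOn
  refine (intervalIntegral.hasDerivAt_integral_of_dominated_loc_of_deriv_le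
    (F' := fun t s => f' (s, t)) (bound := fun _ => C) (closedBall_mem_nhds t one_pos)
    (.of_forall fun u => ?_) ?_ ?_ ?_ (by simp) ?_).2
  · exact Continuous.aestronglyMeasurable (by fun_prop)
  · exact Continuous.intervalIntegrable (by fun_prop) _ _
  · exact Continuous.aestronglyMeasurable (by fun_prop)
  · exact .of_forall fun s hs u hu => hC (s, u) ⟨uIoc_subset_uIcc hs, hu⟩
  · exact .of_forall fun s _ u _ => h s u

variable {A B : ℝ × ℝ → E →L[ℝ] E} {ψ : ℝ × ℝ → E} {x₀ y₀ r : ℝ}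

/-- The connection `d - A dx - B dy` on the trivial bundle over the plane has zero curvature at a
point: `∂A/∂y + A B = ∂B/∂x + B A`, the integrability condition of `ψ_x = A ψ`, `ψ_y = B ψ`. -/
def IsFlatAt (A B : ℝ × ℝ → E →L[ℝ] E) (z : ℝ × ℝ) : Prop :=
  fderiv ℝ A z (0, 1) + A z ∘L B z = fderiv ℝ B z (1, 0) + B z ∘L A z

/-- The values that the equation `ψ_x = A ψ` forces on the plane if `ψ` is trusted on the line
`x = x₀` and in the right-hand side; solutions of the equation are its fixed points. -/
def horizontalTransport (A : ℝ × ℝ → E →L[ℝ] E) (ψ : ℝ × ℝ → E) (x₀ : ℝ) (z : ℝ × ℝ) : E :=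
  ψ (x₀, z.2) + ∫ s in x₀..z.1, A (s, z.2) (ψ (s, z.2))

theorem continuous_horizontalTransport (hA : Continuous A) (hψ : Continuous ψ) :
    Continuous (horizontalTransport A ψ x₀) :=
  .add (by fun_prop) <| intervalIntegral.continuous_parametric_intervalIntegral_of_continuous
    (f := fun (z : ℝ × ℝ) s => A (s, z.2) (ψ (s, z.2))) (by fun_prop) continuous_fst

/-- The linear map `(ξ, η) ↦ ξ A(z) ψ(z) + η B(z) ψ(z)`, the derivative at `z` that a solution `ψ`
of `ψ_x = A ψ`, `ψ_y = B ψ` has to have. -/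
def parallelDeriv (A B : ℝ × ℝ → E →L[ℝ] E) (ψ : ℝ × ℝ → E) (z : ℝ × ℝ) : ℝ × ℝ →L[ℝ] E :=
  (ContinuousLinearMap.toSpanSingleton ℝ (A z (ψ z))).coprod
    (ContinuousLinearMap.toSpanSingleton ℝ (B z (ψ z)))

theorem IsFlatAt.congr {A' B' : ℝ × ℝ → E →L[ℝ] E} {z : ℝ × ℝ} (h : IsFlatAt A B z)
    (hA : A' =ᶠ[𝓝 z] A) (hB : B' =ᶠ[𝓝 z] B) : IsFlatAt A' B' z := by
  rwa [IsFlatAt, hA.fderiv_eq, hB.fderiv_eq, hA.eq_of_nhds, hB.eq_of_nhds]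

theorem exists_contDiff_cutoff {G : Type*} [NormedAddCommGroup G] [NormedSpace ℝ G]
    [FiniteDimensional ℝ G] {n : ℕ∞} {F : G → E} {U : Set G} {z₀ : G} {ρ M : ℝ} (hU : IsOpen U)
    (hF : ContDiffOn ℝ n F U) (hρ : 0 < ρ) (hρU : closedBall z₀ ρ ⊆ U)
    (hM : ∀ z ∈ closedBall z₀ ρ, ‖F z‖ ≤ M) :
    ∃ F' : G → E, ContDiff ℝ n F' ∧ F' =ᶠ[𝓝 z₀] F ∧
      Function.support F' ⊆ closedBall z₀ ρ ∧ ∀ z, ‖F' z‖ ≤ M := by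
  let χ : ContDiffBump z₀ := ⟨ρ / 2, ρ, half_pos hρ, half_lt_self hρ⟩
  have htsupp : tsupport (fun z => χ z • F z) ⊆ closedBall z₀ ρ :=
    (tsupport_smul_subset_left χ F).trans χ.tsupport_eq.subset
  have hsupp := (subset_tsupport _).trans htsupp
  refine ⟨fun z => χ z • F z, contMDiff_iff_contDiff.1 (contMDiff_of_tsupport fun z hz => ?_), ?_,
    hsupp, fun z => ?_⟩
  · exact (χ.contDiffAt.smul (hF.contDiffAt (hU.mem_nhds (hρU (htsupp hz))))).contMDiffAt
  · filter_upwards [χ.eventuallyEq_one] with z hz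
    rw [hz, Pi.one_apply, one_smul]
  · by_cases hz : z ∈ closedBall z₀ ρ
    · rw [norm_smul, Real.norm_of_nonneg χ.nonneg]
      exact (mul_le_of_le_one_left (norm_nonneg _) χ.le_one).trans (hM z hz)
    · have h₀ : χ z • F z = 0 := Function.notMem_support.1 fun h => hz (hsupp h)
      simpa only [h₀, norm_zero] using (norm_nonneg _).trans (hM z₀ (mem_closedBall_self hρ.le))

variable [CompleteSpace E]

theorem hasDerivAt_horizontalTransport_fst (hA : Continuous A) (hψ : Continuous ψ) (x y : ℝ) :
    HasDerivAt (fun t => horizontalTransport A ψ x₀ (t, y)) (A (x, y) (ψ (x, y))) x :=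
  ((hA.clm_apply hψ).comp (Continuous.prodMk_left y)).integral_hasStrictDerivAt x₀ x
    |>.hasDerivAt.const_add (ψ (x₀, y))

theorem intervalIntegral_eq_of_flat (hA : ContDiff ℝ 1 A) (hB : ContDiff ℝ 1 B) (hψ : Continuous ψ)
    (hflat : ∀ z ∈ closedBall (x₀, y₀) r, IsFlatAt A B z) {x y : ℝ}
    (hxy : (x, y) ∈ closedBall (x₀, y₀) r) :
    B (x₀, y) (ψ (x₀, y)) +
        ∫ s in x₀..x, (fderiv ℝ A (s, y) (0, 1) (ψ (s, y)) + A (s, y) (B (s, y) (ψ (s, y)))) =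
      B (x, y) (horizontalTransport A ψ x₀ (x, y)) -
        ∫ s in x₀..x, fderiv ℝ B (s, y) (1, 0) (horizontalTransport A ψ x₀ (s, y) - ψ (s, y)) := by
  have hA₀ := hA.continuous
  have hB₀ := hB.continuous
  have hB₁ := hB.continuous_fderiv one_ne_zero
  have hχ := continuous_horizontalTransport (x₀ := x₀) hA₀ hψ
  set χ := horizontalTransport A ψ x₀
  have hBχ : Continuous fun z => fderiv ℝ B z (1, 0) (χ z) + B z (A z (ψ z)) :=
    ((hB₁.clm_apply continuous_const).clm_apply hχ).add (by fun_prop)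
  have hftc : ∫ s in x₀..x, (fderiv ℝ B (s, y) (1, 0) (χ (s, y)) + B (s, y) (A (s, y) (ψ (s, y)))) =
      B (x, y) (χ (x, y)) - B (x₀, y) (χ (x₀, y)) :=
    intervalIntegral.integral_eq_sub_of_hasDerivAt
      (fun s _ => (hasDerivAt_fst_line (hB.differentiable one_ne_zero _)).clm_apply
        (hasDerivAt_horizontalTransport_fst hA₀ hψ s y))
      ((hBχ.comp (Continuous.prodMk_left y)).intervalIntegrable _ _)
  have hcurv : ∫ s in x₀..x,
      (fderiv ℝ A (s, y) (0, 1) (ψ (s, y)) + A (s, y) (B (s, y) (ψ (s, y)))) =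
      ∫ s in x₀..x, (fderiv ℝ B (s, y) (1, 0) (ψ (s, y)) + B (s, y) (A (s, y) (ψ (s, y)))) :=
    intervalIntegral.integral_congr fun s hs => congrArg (fun S => S (ψ (s, y)))
      (hflat _ (mk_mem_closedBall_of_mem_uIcc hxy hs))
  have hχ₀ : χ (x₀, y) = ψ (x₀, y) := by simp [χ, horizontalTransport]
  rw [hcurv, eq_sub_iff_add_eq, add_assoc, ← intervalIntegral.integral_add,
    ← eq_sub_iff_add_eq', ← hχ₀, ← hftc]
  · refine intervalIntegral.integral_congr fun s _ => ?_
    simp only [map_sub]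
    abel
  all_goals exact Continuous.intervalIntegrable (by fun_prop) _ _

theorem hasDerivAt_horizontalTransport_snd (hA : ContDiff ℝ 1 A) (hB : ContDiff ℝ 1 B)
    (hψ : Continuous ψ) (hψy : ∀ x y, HasDerivAt (fun t => ψ (x, t)) (B (x, y) (ψ (x, y))) y)
    (hflat : ∀ z ∈ closedBall (x₀, y₀) r, IsFlatAt A B z) {x y : ℝ}
    (hxy : (x, y) ∈ closedBall (x₀, y₀) r) :
    HasDerivAt (fun t => horizontalTransport A ψ x₀ (x, t))
      (B (x, y) (horizontalTransport A ψ x₀ (x, y)) - ∫ s in x₀..x,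
        fderiv ℝ B (s, y) (1, 0) (horizontalTransport A ψ x₀ (s, y) - ψ (s, y))) y := by
  have hA₀ := hA.continuous
  have hB₀ := hB.continuous
  have hA₁ := hA.continuous_fderiv one_ne_zero
  rw [← intervalIntegral_eq_of_flat hA hB hψ hflat hxy]
  exact (hψy x₀ y).add <| hasDerivAt_intervalIntegral_of_continuous
    (f := fun z => A z (ψ z)) (f' := fun z => fderiv ℝ A z (0, 1) (ψ z) + A z (B z (ψ z)))
    (by fun_prop) (((hA₁.clm_apply continuous_const).clm_apply hψ).add (by fun_prop))
    (fun s t => (hasDerivAt_snd_line (hA.differentiable one_ne_zero _)).clm_apply (hψy s t)) x₀ x y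

theorem hasDerivAt_fst_of_flat (hA : ContDiff ℝ 1 A) (hB : ContDiff ℝ 1 B) {M N : ℝ}
    (hBM : ∀ z ∈ closedBall (x₀, y₀) r, ‖B z‖ ≤ M)
    (hBN : ∀ z ∈ closedBall (x₀, y₀) r, ‖fderiv ℝ B z (1, 0)‖ ≤ N) (hr : r * (M + r * N) < 1)
    (hψ : Continuous ψ) (hψx : ∀ x, HasDerivAt (fun t => ψ (t, y₀)) (A (x, y₀) (ψ (x, y₀))) x)
    (hψy : ∀ x y, HasDerivAt (fun t => ψ (x, t)) (B (x, y) (ψ (x, y))) y)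
    (hflat : ∀ z ∈ closedBall (x₀, y₀) r, IsFlatAt A B z) {x y : ℝ}
    (hxy : (x, y) ∈ ball (x₀, y₀) r) :
    HasDerivAt (fun t => ψ (t, y)) (A (x, y) (ψ (x, y))) x := by
  set χ := horizontalTransport A ψ x₀
  have hχ : Continuous χ := continuous_horizontalTransport hA.continuous hψ
  have hχ₀ (x : ℝ) : χ (x, y₀) = ψ (x, y₀) := by
    have hcont : Continuous fun s => A (s, y₀) (ψ (s, y₀)) :=
      (hA.continuous.clm_apply hψ).comp (Continuous.prodMk_left y₀)
    simp only [χ, horizontalTransport]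
    rw [intervalIntegral.integral_eq_sub_of_hasDerivAt (fun s _ => hψx s)
      (hcont.intervalIntegrable _ _), add_sub_cancel]
  have heq : EqOn ψ χ (closedBall (x₀, y₀) r) := fun z hz => .symm <| sub_eq_zero.1 <|
    eq_zero_of_hasDerivAt_volterra (δ := fun z => χ z - ψ z) (hχ.sub hψ) hBM hBN hr
      (fun x => sub_eq_zero.2 (hχ₀ x)) (fun x y hxy => by
        have hχy := hasDerivAt_horizontalTransport_snd hA hB hψ hψy hflat hxy
        convert hχy.fun_sub (hψy x y) using 1
        rw [map_sub]
        abel) z hz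
  have hχx := hasDerivAt_horizontalTransport_fst (x₀ := x₀) hA.continuous hψ x y
  refine hχx.congr_of_eventuallyEq ?_
  filter_upwards [(Continuous.prodMk_left y).continuousAt.preimage_mem_nhds
    (isOpen_ball.mem_nhds hxy)] with t ht
  exact heq (ball_subset_closedBall ht)

theorem eventually_hasFDerivAt_of_flat (hA : ContDiff ℝ 1 A) (hB : ContDiff ℝ 1 B)
    (hψ : Continuous ψ) (hψx : ∀ x, HasDerivAt (fun t => ψ (t, y₀)) (A (x, y₀) (ψ (x, y₀))) x)
    (hψy : ∀ x y, HasDerivAt (fun t => ψ (x, t)) (B (x, y) (ψ (x, y))) y)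
    (hflat : ∀ᶠ z in 𝓝 (x₀, y₀), IsFlatAt A B z) :
    ∀ᶠ z in 𝓝 (x₀, y₀), HasFDerivAt ψ (parallelDeriv A B ψ z) z := by
  have hAc := hA.continuous
  have hBc := hB.continuous
  have hBx : Continuous fun z => fderiv ℝ B z (1, 0) :=
    (hB.continuous_fderiv one_ne_zero).clm_apply continuous_const
  obtain ⟨R, hR, hRflat⟩ := nhds_basis_closedBall.eventually_iff.1 hflat
  have hK := isCompact_closedBall (x₀, y₀) R
  obtain ⟨M, hM⟩ := hK.exists_bound_of_continuousOn hBc.continuousOn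
  obtain ⟨N, hN⟩ := hK.exists_bound_of_continuousOn hBx.continuousOn
  have hsmall : ∀ᶠ r in 𝓝 (0 : ℝ), r * (M + r * N) < 1 :=
    ContinuousAt.eventually_lt (by fun_prop) continuousAt_const (by simp)
  obtain ⟨r, ⟨hr, hrR⟩, hr₀ : 0 < r⟩ :=
    ((hsmall.and (eventually_lt_nhds hR)).filter_mono nhdsWithin_le_nhds
      |>.and self_mem_nhdsWithin : ∀ᶠ r in 𝓝[>] (0 : ℝ), _).exists
  have hrR' {z : ℝ × ℝ} (hz : z ∈ closedBall (x₀, y₀) r) : z ∈ closedBall (x₀, y₀) R :=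
    closedBall_subset_closedBall hrR.le hz
  have hψx' {z : ℝ × ℝ} (hz : z ∈ ball (x₀, y₀) r) :
      HasDerivAt (fun t => ψ (t, z.2)) (A z (ψ z)) z.1 :=
    hasDerivAt_fst_of_flat hA hB (fun z hz => hM z (hrR' hz)) (fun z hz => hN z (hrR' hz)) hr hψ hψx
      hψy (fun z hz => hRflat (hrR' hz)) hz
  have hspan (L : ℝ × ℝ → E →L[ℝ] E) (hL : Continuous L) :
      Continuous fun z => ContinuousLinearMap.toSpanSingleton ℝ (L z (ψ z)) :=
    (ContinuousLinearMap.toSpanSingletonCLE (𝕜 := ℝ) (E := E)).continuous.comp (hL.clm_apply hψ)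
  filter_upwards [isOpen_ball.mem_nhds (mem_ball_self hr₀)] with z hz
  exact (hasStrictFDerivAt_uncurry_coprod (f := fun x y => ψ (x, y))
    (f₁ := fun x y => .toSpanSingleton ℝ (A (x, y) (ψ (x, y))))
    (f₂ := fun x y => .toSpanSingleton ℝ (B (x, y) (ψ (x, y))))
    (eventually_of_mem (isOpen_ball.mem_nhds hz) fun w hw => (hψx' hw).hasFDerivAt)
    (.of_forall fun w => (hψy w.1 w.2).hasFDerivAt) (hspan A hAc).continuousAt
    (hspan B hBc).continuousAt).hasFDerivAt

theorem exists_transport_of_small_support {ρ M : ℝ} (hA : Continuous A) (hB : Continuous B)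
    (hρ : 0 ≤ ρ) (hMρ : M * (2 * ρ) < 1) (hAM : ∀ z, ‖A z‖ ≤ M) (hBM : ∀ z, ‖B z‖ ≤ M)
    (hAs : Function.support A ⊆ closedBall (x₀, y₀) ρ)
    (hBs : Function.support B ⊆ closedBall (x₀, y₀) ρ) (v : E) :
    ∃ ψ : ℝ × ℝ → E, Continuous ψ ∧ ψ (x₀, y₀) = v ∧
      (∀ x, HasDerivAt (fun t => ψ (t, y₀)) (A (x, y₀) (ψ (x, y₀))) x) ∧
      ∀ x y, HasDerivAt (fun t => ψ (x, t)) (B (x, y) (ψ (x, y))) y := by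
  rw [← closedBall_prod_same] at hAs hBs
  obtain ⟨φ, hφ₀, hφ⟩ := exists_linear_ode_solution_of_small_support (P := Unit)
    (L := fun z => A (z.2, y₀)) (by fun_prop) hρ (fun z => hAM _) (fun _ t ht => (hAs ht).1) hMρ
    (.const Unit v)
  obtain ⟨ψ, hψ₀, hψ⟩ := exists_linear_ode_solution_of_small_support hB hρ hBM
    (fun _ t ht => (hBs ht).2) hMρ (φ.compContinuous ⟨Prod.mk (), Continuous.prodMk_right _⟩)
  simp only [BoundedContinuousFunction.compContinuous_apply, ContinuousMap.coe_mk] at hψ₀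
  refine ⟨ψ, ψ.continuous, by rw [hψ₀, hφ₀, BoundedContinuousFunction.const_apply], fun x => ?_, hψ⟩
  simpa only [hψ₀] using hφ () x

theorem exists_eventually_hasFDerivAt_of_flat {U : Set (ℝ × ℝ)} (hU : IsOpen U)
    (hA : ContDiffOn ℝ 1 A U) (hB : ContDiffOn ℝ 1 B U) (hflat : ∀ z ∈ U, IsFlatAt A B z)
    {z₀ : ℝ × ℝ} (hz₀ : z₀ ∈ U) (v : E) :
    ∃ ψ : ℝ × ℝ → E, ψ z₀ = v ∧ ∀ᶠ z in 𝓝 z₀, HasFDerivAt ψ (parallelDeriv A B ψ z) z := by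
  obtain ⟨R, hR, hRU⟩ := nhds_basis_closedBall.mem_iff.1 (hU.mem_nhds hz₀)
  have hK := isCompact_closedBall z₀ R
  obtain ⟨M, hM⟩ := hK.exists_bound_of_continuousOn
    ((hA.continuousOn.prodMk hB.continuousOn).mono hRU)
  have hsmall : ∀ᶠ ρ in 𝓝 (0 : ℝ), M * (2 * ρ) < 1 :=
    ContinuousAt.eventually_lt (by fun_prop) continuousAt_const (by simp)
  obtain ⟨ρ, ⟨hMρ, hρR⟩, hρ : 0 < ρ⟩ :=
    ((hsmall.and (eventually_lt_nhds hR)).filter_mono nhdsWithin_le_nhds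
      |>.and self_mem_nhdsWithin : ∀ᶠ ρ in 𝓝[>] (0 : ℝ), _).exists
  have hρR' := closedBall_subset_closedBall (x := z₀) hρR.le
  obtain ⟨A', hA', hAA', hAs, hAM⟩ := exists_contDiff_cutoff hU hA hρ (hρR'.trans hRU)
    fun z hz => (norm_fst_le _).trans (hM z (hρR' hz))
  obtain ⟨B', hB', hBB', hBs, hBM⟩ := exists_contDiff_cutoff hU hB hρ (hρR'.trans hRU)
    fun z hz => (norm_snd_le _).trans (hM z (hρR' hz))
  obtain ⟨ψ, hψ, hψ₀, hψx, hψy⟩ := exists_transport_of_small_support hA'.continuous hB'.continuous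
    hρ.le hMρ hAM hBM hAs hBs v
  refine ⟨ψ, hψ₀, ?_⟩
  have hflat' : ∀ᶠ z in 𝓝 z₀, IsFlatAt A' B' z := by
    filter_upwards [hU.mem_nhds hz₀, hAA'.eventuallyEq_nhds, hBB'.eventuallyEq_nhds]
      with z hz hAz hBz using (hflat z hz).congr hAz hBz
  filter_upwards [eventually_hasFDerivAt_of_flat hA' hB' hψ hψx hψy hflat', hAA', hBB']
    with z hz hAz hBz
  rwa [parallelDeriv, hAz, hBz] at hz

end Frobenius

/-! ### Parallel sections in coordinates -/

section Coordinates

variable {E : Type*} [NormedAddCommGroup E] [NormedSpace ℝ E]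

theorem contDiffOn_of_hasFDerivAt_parallelDeriv {A B : ℝ × ℝ → E →L[ℝ] E} {ψ : ℝ × ℝ → E}
    {V : Set (ℝ × ℝ)} (hV : IsOpen V) (hA : ContDiffOn ℝ ∞ A V) (hB : ContDiffOn ℝ ∞ B V)
    (hψ : ∀ z ∈ V, HasFDerivAt ψ (parallelDeriv A B ψ z) z) : ContDiffOn ℝ ∞ ψ V := by
  rw [contDiffOn_infty]
  intro n
  induction n with
  | zero => exact contDiffOn_zero.2 fun z hz => (hψ z hz).continuousAt.continuousWithinAt
  | succ n ih =>
    push_cast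
    rw [contDiffOn_succ_iff_fderiv_of_isOpen hV]
    refine ⟨fun z hz => (hψ z hz).differentiableAt.differentiableWithinAt, by simp, ?_⟩
    have hspan {L : ℝ × ℝ → E →L[ℝ] E} (hL : ContDiffOn ℝ ∞ L V) :
        ContDiffOn ℝ n (fun z => ContinuousLinearMap.toSpanSingleton ℝ (L z (ψ z))) V :=
      (ContinuousLinearMap.toSpanSingletonCLE (𝕜 := ℝ) (E := E)).contDiff.comp_contDiffOn
        ((hL.of_le (by exact_mod_cast le_top)).clm_apply ih)
    have hfderiv : ContDiffOn ℝ n (fun z =>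
        .toSpanSingleton ℝ (A z (ψ z)) ∘L .fst ℝ ℝ ℝ + .toSpanSingleton ℝ (B z (ψ z)) ∘L .snd ℝ ℝ ℝ)
        V :=
      ((hspan hA).clm_comp contDiffOn_const).add ((hspan hB).clm_comp contDiffOn_const)
    refine hfderiv.congr fun z hz => ?_
    rw [(hψ z hz).fderiv]
    exact (ContinuousLinearMap.comp_fst_add_comp_snd _ _).symm

theorem exists_contDiffOn_parallel_of_flat [CompleteSpace E] {A B : ℝ × ℝ → E →L[ℝ] E}
    {U : Set (ℝ × ℝ)} (hU : IsOpen U) (hA : ContDiffOn ℝ ∞ A U) (hB : ContDiffOn ℝ ∞ B U)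
    (hflat : ∀ z ∈ U, IsFlatAt A B z) {z₀ : ℝ × ℝ} (hz₀ : z₀ ∈ U) (v : E) :
    ∃ V : Set (ℝ × ℝ), ∃ ψ : ℝ × ℝ → E, IsOpen V ∧ z₀ ∈ V ∧ V ⊆ U ∧ ContDiffOn ℝ ∞ ψ V ∧
      ψ z₀ = v ∧ ∀ z ∈ V, HasFDerivAt ψ (parallelDeriv A B ψ z) z := by
  have h1 : (1 : WithTop ℕ∞) ≤ ∞ := by exact_mod_cast le_top
  obtain ⟨ψ, hψ₀, hψ⟩ :=
    exists_eventually_hasFDerivAt_of_flat hU (hA.of_le h1) (hB.of_le h1) hflat hz₀ v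
  obtain ⟨V, hVψ, hV, hzV⟩ := _root_.eventually_nhds_iff.1 (hψ.and (hU.mem_nhds hz₀))
  have hVU : V ⊆ U := fun z hz => (hVψ z hz).2
  exact ⟨V, ψ, hV, hzV, hVU, contDiffOn_of_hasFDerivAt_parallelDeriv hV (hA.mono hVU) (hB.mono hVU)
    fun z hz => (hVψ z hz).1, hψ₀, fun z hz => (hVψ z hz).1⟩

variable {ι : Type*} [Fintype ι]

/-- The continuous linear map `w ↦ m w` of a square matrix `m`, as a continuous linear function of
`m`. Matrices are plain functions `ι → ι → ℝ` here, since `Matrix ι ι ℝ` carries no canonical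
norm. -/
def mulVecCLM : (ι → ι → ℝ) →L[ℝ] (ι → ℝ) →L[ℝ] (ι → ℝ) :=
  LinearMap.toContinuousLinearMap <| (LinearMap.toContinuousLinearMap : _ ≃ₗ[ℝ] _).toLinearMap ∘ₗ
    (Matrix.mulVecBilin ℝ ℝ : Matrix ι ι ℝ →ₗ[ℝ] _)

theorem mulVecCLM_apply (m : ι → ι → ℝ) (w : ι → ℝ) (i : ι) :
    mulVecCLM m w i = ∑ k, m i k * w k :=
  rfl

theorem mulVecCLM_comp_mulVecCLM (m m' : ι → ι → ℝ) :
    mulVecCLM m ∘L mulVecCLM m' = mulVecCLM fun i j => ∑ k, m i k * m' k j := by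
  ext1 w
  exact Matrix.mulVec_mulVec w m m'

theorem fderiv_mulVecCLM_comp {a : ι → ι → ℝ × ℝ → ℝ} {z : ℝ × ℝ}
    (ha : ∀ i j, DifferentiableAt ℝ (a i j) z) (w : ℝ × ℝ) :
    fderiv ℝ (fun z => mulVecCLM fun i j => a i j z) z w =
      mulVecCLM fun i j => fderiv ℝ (a i j) z w := by
  have hmat : HasFDerivAt (fun z i j => a i j z) (.pi fun i => .pi fun j => fderiv ℝ (a i j) z) z :=
    hasFDerivAt_pi.2 fun i => hasFDerivAt_pi.2 fun j => (ha i j).hasFDerivAt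
  exact congrArg (fun S => S w) (mulVecCLM.hasFDerivAt.comp z hmat).fderiv

theorem isFlatAt_mulVecCLM {a b : ι → ι → ℝ × ℝ → ℝ} {z : ℝ × ℝ}
    (ha : ∀ i j, DifferentiableAt ℝ (a i j) z) (hb : ∀ i j, DifferentiableAt ℝ (b i j) z)
    (hflat : ∀ i j, dy (a i j) z + ∑ k, a i k z * b k j z =
      dx (b i j) z + ∑ k, b i k z * a k j z) :
    IsFlatAt (fun z => mulVecCLM fun i j => a i j z) (fun z => mulVecCLM fun i j => b i j z) z := by
  rw [IsFlatAt, fderiv_mulVecCLM_comp ha, fderiv_mulVecCLM_comp hb, mulVecCLM_comp_mulVecCLM,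
    mulVecCLM_comp_mulVecCLM, ← map_add, ← map_add]
  congr 1
  ext i j
  exact hflat i j

theorem exists_parallel_coordinates {a b : ι → ι → ℝ × ℝ → ℝ} {U : Set (ℝ × ℝ)}
    (hU : IsOpen U) (ha : ∀ i j, ContDiffOn ℝ ∞ (a i j) U) (hb : ∀ i j, ContDiffOn ℝ ∞ (b i j) U)
    (hflat : ∀ z ∈ U, ∀ i j, dy (a i j) z + ∑ k, a i k z * b k j z =
      dx (b i j) z + ∑ k, b i k z * a k j z)
    {z₀ : ℝ × ℝ} (hz₀ : z₀ ∈ U) (v : ι → ℝ) :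
    ∃ V : Set (ℝ × ℝ), ∃ ψ : ι → ℝ × ℝ → ℝ, IsOpen V ∧ z₀ ∈ V ∧ V ⊆ U ∧
      (∀ i, ContDiffOn ℝ ∞ (ψ i) V) ∧ (∀ i, ψ i z₀ = v i) ∧
      ∀ z ∈ V, ∀ i, dx (ψ i) z = ∑ k, a i k z * ψ k z ∧ dy (ψ i) z = ∑ k, b i k z * ψ k z := by
  have hsmooth {m : ι → ι → ℝ × ℝ → ℝ} (hm : ∀ i j, ContDiffOn ℝ ∞ (m i j) U) :
      ContDiffOn ℝ ∞ (fun z => mulVecCLM fun i j => m i j z) U :=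
    (mulVecCLM (ι := ι)).contDiff.comp_contDiffOn
      (contDiffOn_pi.2 fun i => contDiffOn_pi.2 fun j => hm i j)
  obtain ⟨V, ψ, hV, hzV, hVU, hψ, hψ₀, hψ'⟩ := exists_contDiffOn_parallel_of_flat hU (hsmooth ha)
    (hsmooth hb) (fun z hz => isFlatAt_mulVecCLM
      (fun i j => differentiableAt_of_contDiffOn hU (ha i j) hz)
      (fun i j => differentiableAt_of_contDiffOn hU (hb i j) hz) (hflat z hz)) hz₀ v
  refine ⟨V, fun i z => ψ z i, hV, hzV, hVU, contDiffOn_pi.1 hψ, congrFun hψ₀, fun z hz i => ?_⟩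
  have hψi := (hasFDerivAt_pi'.1 (hψ' z hz) i).fderiv
  simp [dx, dy, hψi, parallelDeriv, mulVecCLM_apply]

end Coordinates

/-! ### Calculus of the partial derivatives -/

section Calculus

variable {f g : ℝ × ℝ → ℝ} {z : ℝ × ℝ} {U : Set (ℝ × ℝ)}

theorem dx_const (r : ℝ) : dx (fun _ => r) z = 0 := by simp [dx]

theorem dy_const (r : ℝ) : dy (fun _ => r) z = 0 := by simp [dy]

theorem dx_add (hf : DifferentiableAt ℝ f z) (hg : DifferentiableAt ℝ g z) :
    dx (fun w => f w + g w) z = dx f z + dx g z := by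
  simp [dx, fderiv_fun_add hf hg]

theorem dy_add (hf : DifferentiableAt ℝ f z) (hg : DifferentiableAt ℝ g z) :
    dy (fun w => f w + g w) z = dy f z + dy g z := by
  simp [dy, fderiv_fun_add hf hg]

theorem dx_sub (hf : DifferentiableAt ℝ f z) (hg : DifferentiableAt ℝ g z) :
    dx (fun w => f w - g w) z = dx f z - dx g z := by
  simp [dx, fderiv_fun_sub hf hg]

theorem dy_sub (hf : DifferentiableAt ℝ f z) (hg : DifferentiableAt ℝ g z) :
    dy (fun w => f w - g w) z = dy f z - dy g z := by
  simp [dy, fderiv_fun_sub hf hg]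

theorem dx_neg : dx (fun w => -f w) z = -dx f z := by
  simp [dx, fderiv_fun_neg]

theorem dy_neg : dy (fun w => -f w) z = -dy f z := by
  simp [dy, fderiv_fun_neg]

theorem dx_mul (hf : DifferentiableAt ℝ f z) (hg : DifferentiableAt ℝ g z) :
    dx (fun w => f w * g w) z = dx f z * g z + f z * dx g z := by
  simp [dx, fderiv_fun_mul hf hg]; ring

theorem dy_mul (hf : DifferentiableAt ℝ f z) (hg : DifferentiableAt ℝ g z) :
    dy (fun w => f w * g w) z = dy f z * g z + f z * dy g z := by
  simp [dy, fderiv_fun_mul hf hg]; ring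

theorem dx_div (hf : DifferentiableAt ℝ f z) (hg : DifferentiableAt ℝ g z) (h : g z ≠ 0) :
    dx (fun w => f w / g w) z = (dx f z * g z - f z * dx g z) / g z ^ 2 :=
  (hasDerivAt_fst_line (differentiableAt_div hf hg h)).unique
    ((hasDerivAt_fst_line hf).fun_div (hasDerivAt_fst_line hg) h)

theorem dy_div (hf : DifferentiableAt ℝ f z) (hg : DifferentiableAt ℝ g z) (h : g z ≠ 0) :
    dy (fun w => f w / g w) z = (dy f z * g z - f z * dy g z) / g z ^ 2 :=
  (hasDerivAt_snd_line (differentiableAt_div hf hg h)).unique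
    ((hasDerivAt_snd_line hf).fun_div (hasDerivAt_snd_line hg) h)

theorem dx_div_const (hf : DifferentiableAt ℝ f z) (r : ℝ) :
    dx (fun w => f w / r) z = dx f z / r := by
  simp only [div_eq_mul_inv, dx_mul hf (differentiableAt_const _), dx_const, mul_zero, add_zero]

theorem dy_div_const (hf : DifferentiableAt ℝ f z) (r : ℝ) :
    dy (fun w => f w / r) z = dy f z / r := by
  simp only [div_eq_mul_inv, dy_mul hf (differentiableAt_const _), dy_const, mul_zero, add_zero]

theorem dx_congr (hU : IsOpen U) (h : EqOn f g U) (hz : z ∈ U) : dx f z = dx g z := by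
  rw [dx, dx, (h.eventuallyEq_of_mem (hU.mem_nhds hz)).fderiv_eq]

theorem dy_congr (hU : IsOpen U) (h : EqOn f g U) (hz : z ∈ U) : dy f z = dy g z := by
  rw [dy, dy, (h.eventuallyEq_of_mem (hU.mem_nhds hz)).fderiv_eq]

@[fun_prop]
theorem contDiffOn_dx (hU : IsOpen U) (hf : ContDiffOn ℝ ∞ f U) : ContDiffOn ℝ ∞ (dx f) U :=
  contDiffOn_fderiv_apply_const hU hf (1, 0)

@[fun_prop]
theorem contDiffOn_dy (hU : IsOpen U) (hf : ContDiffOn ℝ ∞ f U) : ContDiffOn ℝ ∞ (dy f) U :=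
  contDiffOn_fderiv_apply_const hU hf (0, 1)

@[fun_prop]
theorem differentiableAt_dx (hf : ContDiffAt ℝ 2 f z) : DifferentiableAt ℝ (dx f) z :=
  ((hf.fderiv_right (m := 1) (by norm_num)).differentiableAt one_ne_zero).clm_apply
    (differentiableAt_const _)

@[fun_prop]
theorem differentiableAt_dy (hf : ContDiffAt ℝ 2 f z) : DifferentiableAt ℝ (dy f) z :=
  ((hf.fderiv_right (m := 1) (by norm_num)).differentiableAt one_ne_zero).clm_apply
    (differentiableAt_const _)

theorem dy_dx_comm (hf : ContDiffAt ℝ 2 f z) : dy (dx f) z = dx (dy f) z := by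
  have hf' : DifferentiableAt ℝ (fderiv ℝ f) z :=
    (hf.fderiv_right (m := 1) (by norm_num)).differentiableAt one_ne_zero
  have hsecond (v w : ℝ × ℝ) :
      fderiv ℝ (fun z => fderiv ℝ f z v) z w = fderiv ℝ (fderiv ℝ f) z w v := by
    rw [fderiv_clm_apply hf' (differentiableAt_const v)]
    simp
  exact (hsecond _ _).trans ((hf.isSymmSndFDerivAt (by simp) _ _).trans (hsecond _ _).symm)

theorem exists_isOpen_injOn_of_jacobian_ne_zero {X Y : ℝ × ℝ → ℝ} (hX : ContDiffAt ℝ 1 X z)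
    (hY : ContDiffAt ℝ 1 Y z) (hJ : dx X z * dy Y z - dy X z * dx Y z ≠ 0) :
    ∃ V : Set (ℝ × ℝ), IsOpen V ∧ z ∈ V ∧ InjOn (fun w => (X w, Y w)) V ∧
      ∀ w ∈ V, dx X w * dy Y w - dy X w * dx Y w ≠ 0 := by
  let D : ℝ × ℝ →L[ℝ] ℝ × ℝ := (fderiv ℝ X z).prod (fderiv ℝ Y z)
  have hD (u : ℝ × ℝ) : D u = (u.1 * dx X z + u.2 * dy X z, u.1 * dx Y z + u.2 * dy Y z) := by
    have happly (f : ℝ × ℝ →L[ℝ] ℝ) : f u = u.1 * f (1, 0) + u.2 * f (0, 1) := by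
      rw [← smul_eq_mul, ← smul_eq_mul, ← map_smul, ← map_smul, ← map_add]
      simp
    exact Prod.ext (happly _) (happly _)
  have hDinj : Function.Injective (D : ℝ × ℝ →ₗ[ℝ] ℝ × ℝ) := by
    refine (injective_iff_map_eq_zero _).2 fun u hu => ?_
    obtain ⟨h₁, h₂⟩ := Prod.mk_eq_zero.1 ((hD u).symm.trans hu)
    refine Prod.ext ((mul_eq_zero_iff_right hJ).1 ?_) ((mul_eq_zero_iff_right hJ).1 ?_)
    · linear_combination dy Y z * h₁ - dy X z * h₂
    · linear_combination dx X z * h₂ - dx Y z * h₁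
  have hstrict : HasStrictFDerivAt (fun w => (X w, Y w))
      ((LinearEquiv.ofInjectiveEndo _ hDinj).toContinuousLinearEquiv : ℝ × ℝ →L[ℝ] ℝ × ℝ) z :=
    (hX.hasStrictFDerivAt one_ne_zero).prodMk (hY.hasStrictFDerivAt one_ne_zero)
  have hJ' : ∀ᶠ w in 𝓝 z, dx X w * dy Y w - dy X w * dx Y w ≠ 0 := by
    have hX' := (hX.fderiv_right (m := 0) (by norm_num)).continuousAt
    have hY' := (hY.fderiv_right (m := 0) (by norm_num)).continuousAt
    refine ContinuousAt.eventually_ne ?_ hJ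
    unfold dx dy
    fun_prop
  have hsource := hstrict.toOpenPartialHomeomorph.open_source.mem_nhds
    hstrict.mem_toOpenPartialHomeomorph_source
  obtain ⟨V, hV, hVopen, hzV⟩ := _root_.eventually_nhds_iff.1 (hJ'.and hsource)
  exact ⟨V, hVopen, hzV, hstrict.toOpenPartialHomeomorph.injOn.mono fun w hw => (hV w hw).2,
    fun w hw => (hV w hw).1⟩

end Calculus

/-! ### The projective Hessian of a cubic second-order equation -/

section ProjectiveHessian

/-- The coefficient of `w` in the formula for `w_xx` in `ProjectiveHessian`. -/
def projectiveXX (g h d : ℝ × ℝ → ℝ) (z : ℝ × ℝ) : ℝ :=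
  dy d z + dx h z / 3 - 2 / 3 * (d z * g z) + 2 / 9 * (h z * h z)

/-- The coefficient of `w` in the formula for `w_xy` in `ProjectiveHessian`. -/
def projectiveXY (c g h d : ℝ × ℝ → ℝ) (z : ℝ × ℝ) : ℝ :=
  c z * d z - g z * h z / 9 - (dy h z + dx g z) / 3

/-- The coefficient of `w` in the formula for `w_yy` in `ProjectiveHessian`. -/
def projectiveYY (c g h : ℝ × ℝ → ℝ) (z : ℝ × ℝ) : ℝ :=
  dx c z + dy g z / 3 - 2 / 3 * (h z * c z) + 2 / 9 * (g z * g z)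

/-- The linear system of second order whose ratios of solutions linearize
`y'' + c y'³ - g y'² + h y' - d = 0`. -/
def ProjectiveHessian (c g h d w : ℝ × ℝ → ℝ) (z : ℝ × ℝ) : Prop :=
  dx (dx w) z = projectiveXX g h d z * w z - h z / 3 * dx w z - d z * dy w z ∧
  dx (dy w) z = projectiveXY c g h d z * w z + g z / 3 * dx w z + h z / 3 * dy w z ∧
  dy (dy w) z = projectiveYY c g h z * w z - c z * dx w z - g z / 3 * dy w z

/-- The matrix `A` for which `ProjectiveHessian` reads `ψ_x = A ψ`, `ψ_y = B ψ` with
`ψ = (w, w_x, w_y)` and `B = projectiveConnY`. -/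
def projectiveConnX (c g h d : ℝ × ℝ → ℝ) : Fin 3 → Fin 3 → ℝ × ℝ → ℝ :=
  ![![fun _ => 0, fun _ => 1, fun _ => 0],
    ![projectiveXX g h d, fun z => -(h z / 3), fun z => -d z],
    ![projectiveXY c g h d, fun z => g z / 3, fun z => h z / 3]]

/-- The matrix `B` for which `ProjectiveHessian` reads `ψ_x = A ψ`, `ψ_y = B ψ` with
`ψ = (w, w_x, w_y)` and `A = projectiveConnX`. -/
def projectiveConnY (c g h d : ℝ × ℝ → ℝ) : Fin 3 → Fin 3 → ℝ × ℝ → ℝ :=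
  ![![fun _ => 0, fun _ => 0, fun _ => 1],
    ![projectiveXY c g h d, fun z => g z / 3, fun z => h z / 3],
    ![projectiveYY c g h, fun z => -c z, fun z => -(g z / 3)]]

variable {c g h d : ℝ × ℝ → ℝ} {z : ℝ × ℝ} {U : Set (ℝ × ℝ)}

theorem dy_projectiveXX (hg : DifferentiableAt ℝ g z) (hh : ContDiffAt ℝ 2 h z)
    (hd : ContDiffAt ℝ 2 d z) :
    dy (projectiveXX g h d) z = dy (dy d) z + dx (dy h) z / 3
      - 2 / 3 * (dy d z * g z + d z * dy g z) + 4 / 9 * (h z * dy h z) := by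
  have hh' := hh.differentiableAt two_ne_zero
  have hd' := hd.differentiableAt two_ne_zero
  unfold projectiveXX
  simp (disch := fun_prop) only [dy_add, dy_sub, dy_mul, dy_const, dy_div_const, dy_dx_comm hh]
  ring

theorem dx_projectiveXY (hc : DifferentiableAt ℝ c z) (hg : ContDiffAt ℝ 2 g z)
    (hh : ContDiffAt ℝ 2 h z) (hd : DifferentiableAt ℝ d z) :
    dx (projectiveXY c g h d) z = dx c z * d z + c z * dx d z
      - (dx g z * h z + g z * dx h z) / 9 - (dx (dy h) z + dx (dx g) z) / 3 := by
  have hg' := hg.differentiableAt two_ne_zero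
  have hh' := hh.differentiableAt two_ne_zero
  unfold projectiveXY
  simp (disch := fun_prop) only [dx_add, dx_sub, dx_mul, dx_div_const]

theorem dy_projectiveXY (hc : DifferentiableAt ℝ c z) (hg : ContDiffAt ℝ 2 g z)
    (hh : ContDiffAt ℝ 2 h z) (hd : DifferentiableAt ℝ d z) :
    dy (projectiveXY c g h d) z = dy c z * d z + c z * dy d z
      - (dy g z * h z + g z * dy h z) / 9 - (dy (dy h) z + dx (dy g) z) / 3 := by
  have hg' := hg.differentiableAt two_ne_zero
  have hh' := hh.differentiableAt two_ne_zero
  unfold projectiveXY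
  simp (disch := fun_prop) only [dy_add, dy_sub, dy_mul, dy_div_const, dy_dx_comm hg]

theorem dx_projectiveYY (hc : ContDiffAt ℝ 2 c z) (hg : ContDiffAt ℝ 2 g z)
    (hh : DifferentiableAt ℝ h z) :
    dx (projectiveYY c g h) z = dx (dx c) z + dx (dy g) z / 3
      - 2 / 3 * (dx h z * c z + h z * dx c z) + 4 / 9 * (g z * dx g z) := by
  have hc' := hc.differentiableAt two_ne_zero
  have hg' := hg.differentiableAt two_ne_zero
  unfold projectiveYY
  simp (disch := fun_prop) only [dx_add, dx_sub, dx_mul, dx_const, dx_div_const]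
  ring

theorem projectiveConn_flat (hc : ContDiffAt ℝ 2 c z) (hg : ContDiffAt ℝ 2 g z)
    (hh : ContDiffAt ℝ 2 h z) (hd : ContDiffAt ℝ 2 d z) (hLT : LieTresse c g h d z) (i j : Fin 3) :
    dy (projectiveConnX c g h d i j) z
        + ∑ k, projectiveConnX c g h d i k z * projectiveConnY c g h d k j z =
      dx (projectiveConnY c g h d i j) z
        + ∑ k, projectiveConnY c g h d i k z * projectiveConnX c g h d k j z := by
  have hc' := hc.differentiableAt two_ne_zero
  have hg' := hg.differentiableAt two_ne_zero
  have hh' := hh.differentiableAt two_ne_zero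
  have hd' := hd.differentiableAt two_ne_zero
  obtain ⟨hLT₁, hLT₂⟩ := hLT
  rw [dx_mul hc' hh'] at hLT₁
  rw [dy_mul hd' hg'] at hLT₂
  fin_cases i <;> fin_cases j <;>
    simp [projectiveConnX, projectiveConnY, Fin.sum_univ_three, dx_const, dy_const, dx_neg, dy_neg,
      dx_div_const, dy_div_const, dy_projectiveXX, dx_projectiveXY, dy_projectiveXY,
      dx_projectiveYY, *] <;>
    simp only [projectiveXX, projectiveXY, projectiveYY]
  · linear_combination (-1 / 3 : ℝ) * hLT₂
  · ring
  · ring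
  · linear_combination (1 / 3 : ℝ) * hLT₁
  · ring
  · ring

theorem contDiffOn_projectiveXX (hU : IsOpen U) (hg : ContDiffOn ℝ ∞ g U)
    (hh : ContDiffOn ℝ ∞ h U) (hd : ContDiffOn ℝ ∞ d U) :
    ContDiffOn ℝ ∞ (projectiveXX g h d) U := by
  unfold projectiveXX
  fun_prop (disch := assumption)

theorem contDiffOn_projectiveXY (hU : IsOpen U) (hc : ContDiffOn ℝ ∞ c U)
    (hg : ContDiffOn ℝ ∞ g U) (hh : ContDiffOn ℝ ∞ h U) (hd : ContDiffOn ℝ ∞ d U) :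
    ContDiffOn ℝ ∞ (projectiveXY c g h d) U := by
  unfold projectiveXY
  fun_prop (disch := assumption)

theorem contDiffOn_projectiveYY (hU : IsOpen U) (hc : ContDiffOn ℝ ∞ c U)
    (hg : ContDiffOn ℝ ∞ g U) (hh : ContDiffOn ℝ ∞ h U) :
    ContDiffOn ℝ ∞ (projectiveYY c g h) U := by
  unfold projectiveYY
  fun_prop (disch := assumption)

theorem contDiffOn_projectiveConnX (hU : IsOpen U) (hc : ContDiffOn ℝ ∞ c U)
    (hg : ContDiffOn ℝ ∞ g U) (hh : ContDiffOn ℝ ∞ h U) (hd : ContDiffOn ℝ ∞ d U) (i j : Fin 3) :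
    ContDiffOn ℝ ∞ (projectiveConnX c g h d i j) U := by
  have hXX := contDiffOn_projectiveXX hU hg hh hd
  have hXY := contDiffOn_projectiveXY hU hc hg hh hd
  fin_cases i <;> fin_cases j
  exacts [contDiffOn_const, contDiffOn_const, contDiffOn_const, hXX, (hh.div_const 3).neg, hd.neg,
    hXY, hg.div_const 3, hh.div_const 3]

theorem contDiffOn_projectiveConnY (hU : IsOpen U) (hc : ContDiffOn ℝ ∞ c U)
    (hg : ContDiffOn ℝ ∞ g U) (hh : ContDiffOn ℝ ∞ h U) (hd : ContDiffOn ℝ ∞ d U) (i j : Fin 3) :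
    ContDiffOn ℝ ∞ (projectiveConnY c g h d i j) U := by
  have hXY := contDiffOn_projectiveXY hU hc hg hh hd
  have hYY := contDiffOn_projectiveYY hU hc hg hh
  fin_cases i <;> fin_cases j
  exacts [contDiffOn_const, contDiffOn_const, contDiffOn_const, hXY, hg.div_const 3,
    hh.div_const 3, hYY, hc.neg, (hg.div_const 3).neg]

theorem exists_projectiveHessian_solution (hU : IsOpen U) (hc : ContDiffOn ℝ ∞ c U)
    (hg : ContDiffOn ℝ ∞ g U) (hh : ContDiffOn ℝ ∞ h U) (hd : ContDiffOn ℝ ∞ d U)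
    (hLT : ∀ z ∈ U, LieTresse c g h d z) {z₀ : ℝ × ℝ} (hz₀ : z₀ ∈ U) (v : Fin 3 → ℝ) :
    ∃ (V : Set (ℝ × ℝ)) (w : ℝ × ℝ → ℝ), IsOpen V ∧ z₀ ∈ V ∧ V ⊆ U ∧ ContDiffOn ℝ ∞ w V ∧
      w z₀ = v 0 ∧ dx w z₀ = v 1 ∧ dy w z₀ = v 2 ∧ ∀ z ∈ V, ProjectiveHessian c g h d w z := by
  obtain ⟨V, ψ, hV, hzV, hVU, hψ, hψ₀, hψ'⟩ := exists_parallel_coordinates hU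
    (contDiffOn_projectiveConnX hU hc hg hh hd) (contDiffOn_projectiveConnY hU hc hg hh hd)
    (fun z hz => projectiveConn_flat (contDiffAt_two_of_contDiffOn hU hc hz)
      (contDiffAt_two_of_contDiffOn hU hg hz) (contDiffAt_two_of_contDiffOn hU hh hz)
      (contDiffAt_two_of_contDiffOn hU hd hz) (hLT z hz)) hz₀ v
  have hx : EqOn (dx (ψ 0)) (ψ 1) V := fun z hz => by
    simpa [projectiveConnX, Fin.sum_univ_three] using (hψ' z hz 0).1
  have hy : EqOn (dy (ψ 0)) (ψ 2) V := fun z hz => by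
    simpa [projectiveConnY, Fin.sum_univ_three] using (hψ' z hz 0).2
  refine ⟨V, ψ 0, hV, hzV, hVU, hψ 0, hψ₀ 0, by rw [hx hzV, hψ₀], by rw [hy hzV, hψ₀],
    fun z hz => ⟨?_, ?_, ?_⟩⟩
  · rw [dx_congr hV hx hz, hx hz, hy hz, (hψ' z hz 1).1]
    simp [projectiveConnX, Fin.sum_univ_three]
    ring
  · rw [dx_congr hV hy hz, hx hz, hy hz, (hψ' z hz 2).1]
    simp [projectiveConnX, Fin.sum_univ_three]
  · rw [dy_congr hV hy hz, hx hz, hy hz, (hψ' z hz 2).2]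
    simp [projectiveConnY, Fin.sum_univ_three]
    ring

theorem exists_projectiveHessian_frame (hU : IsOpen U) (hc : ContDiffOn ℝ ∞ c U)
    (hg : ContDiffOn ℝ ∞ g U) (hh : ContDiffOn ℝ ∞ h U) (hd : ContDiffOn ℝ ∞ d U)
    (hLT : ∀ z ∈ U, LieTresse c g h d z) {z₀ : ℝ × ℝ} (hz₀ : z₀ ∈ U) :
    ∃ (V : Set (ℝ × ℝ)) (w : Fin 3 → ℝ × ℝ → ℝ), IsOpen V ∧ z₀ ∈ V ∧ V ⊆ U ∧
      (∀ i, ContDiffOn ℝ ∞ (w i) V) ∧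
      (∀ i, ![w i z₀, dx (w i) z₀, dy (w i) z₀] = Pi.single i 1) ∧
      (∀ z ∈ V, ∀ i, ProjectiveHessian c g h d (w i) z) ∧ ∀ z ∈ V, w 0 z ≠ 0 := by
  choose V w hV hzV hVU hw hw₀ hwx hwy hH using fun i : Fin 3 =>
    exists_projectiveHessian_solution hU hc hg hh hd hLT hz₀ (Pi.single i 1)
  have hjet (i : Fin 3) : ![w i z₀, dx (w i) z₀, dy (w i) z₀] = Pi.single i 1 := by
    ext j
    fin_cases j
    exacts [hw₀ i, hwx i, hwy i]
  have hne : V 0 ∩ w 0 ⁻¹' {0}ᶜ ∈ 𝓝 z₀ :=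
    ((hw 0).continuousOn.isOpen_inter_preimage (hV 0) isOpen_compl_singleton).mem_nhds
      ⟨hzV 0, by simp [hw₀]⟩
  obtain ⟨W, hWsub, hW, hzW⟩ := _root_.mem_nhds_iff.1
    (inter_mem (iInter_mem.2 fun i => (hV i).mem_nhds (hzV i)) hne)
  have hWV (i : Fin 3) : W ⊆ V i := fun z hz => mem_iInter.1 (hWsub hz).1 i
  exact ⟨W, w, hW, hzW, (hWV 0).trans (hVU 0), fun i => (hw i).mono (hWV i), hjet,
    fun z hz i => hH i z (hWV i hz), fun z hz => (hWsub hz).2.2⟩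

end ProjectiveHessian

/-! ### Affine coordinates -/

section AffineCoordinates

variable {a b c d e f g h X Y w w₀ : ℝ × ℝ → ℝ} {z : ℝ × ℝ} {U V : Set (ℝ × ℝ)}

/-- `X` has parallel differential at `z` for the connection with `Γ¹₁₁ = -a`, `Γ¹₁₂ = -b`,
`Γ¹₂₂ = -c`, `Γ²₁₁ = -d`, `Γ²₁₂ = -e`, `Γ²₂₂ = -f`. -/
def IsAffineFunctionAt (a b c d e f X : ℝ × ℝ → ℝ) (z : ℝ × ℝ) : Prop :=
  dx (dx X) z = -(a z * dx X z) - d z * dy X z ∧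
  dx (dy X) z = -(b z * dx X z) - e z * dy X z ∧
  dy (dy X) z = -(c z * dx X z) - f z * dy X z

/-- The coefficient `b = -Γ¹₁₂` of the connection whose affine functions are the ratios `w / w₀`
of solutions of `ProjectiveHessian`. -/
def christoffelB (g w₀ : ℝ × ℝ → ℝ) (z : ℝ × ℝ) : ℝ := dy w₀ z / w₀ z - g z / 3

/-- The coefficient `e = -Γ²₁₂` of the connection whose affine functions are the ratios `w / w₀`
of solutions of `ProjectiveHessian`. -/
def christoffelE (h w₀ : ℝ × ℝ → ℝ) (z : ℝ × ℝ) : ℝ := dx w₀ z / w₀ z - h z / 3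

theorem contDiffOn_christoffelB (hU : IsOpen U) (hg : ContDiffOn ℝ ∞ g U)
    (hw₀ : ContDiffOn ℝ ∞ w₀ U) (hne : ∀ z ∈ U, w₀ z ≠ 0) :
    ContDiffOn ℝ ∞ (christoffelB g w₀) U :=
  ((contDiffOn_dy hU hw₀).div hw₀ hne).sub (hg.div_const 3)

theorem contDiffOn_christoffelE (hU : IsOpen U) (hh : ContDiffOn ℝ ∞ h U)
    (hw₀ : ContDiffOn ℝ ∞ w₀ U) (hne : ∀ z ∈ U, w₀ z ≠ 0) :
    ContDiffOn ℝ ∞ (christoffelE h w₀) U :=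
  ((contDiffOn_dx hU hw₀).div hw₀ hne).sub (hh.div_const 3)

theorem isAffineFunctionAt_div (hV : IsOpen V) (hw : ContDiffOn ℝ ∞ w V)
    (hw₀ : ContDiffOn ℝ ∞ w₀ V) (hne : ∀ z ∈ V, w₀ z ≠ 0) (hz : z ∈ V)
    (hHw : ProjectiveHessian c g h d w z) (hHw₀ : ProjectiveHessian c g h d w₀ z) :
    IsAffineFunctionAt (fun z => h z + 2 * christoffelE h w₀ z) (christoffelB g w₀) c d
      (christoffelE h w₀) (fun z => g z + 2 * christoffelB g w₀ z) (fun z => w z / w₀ z) z := by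
  have hX : EqOn (dx fun z => w z / w₀ z)
      (fun z => (dx w z * w₀ z - w z * dx w₀ z) / (w₀ z * w₀ z)) V := fun z hz => by
    rw [dx_div (differentiableAt_of_contDiffOn hV hw hz) (differentiableAt_of_contDiffOn hV hw₀ hz)
      (hne z hz), sq]
  have hY : EqOn (dy fun z => w z / w₀ z)
      (fun z => (dy w z * w₀ z - w z * dy w₀ z) / (w₀ z * w₀ z)) V := fun z hz => by
    rw [dy_div (differentiableAt_of_contDiffOn hV hw hz) (differentiableAt_of_contDiffOn hV hw₀ hz)
      (hne z hz), sq]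
  obtain ⟨hxx, hxy, hyy⟩ := hHw
  obtain ⟨hxx₀, hxy₀, hyy₀⟩ := hHw₀
  have hz₀ := hne z hz
  have hsq : w₀ z * w₀ z ≠ 0 := mul_ne_zero hz₀ hz₀
  have hw₂ := contDiffAt_two_of_contDiffOn hV hw hz
  have hw₀₂ := contDiffAt_two_of_contDiffOn hV hw₀ hz
  have hw₁ := hw₂.differentiableAt two_ne_zero
  have hw₀₁ := hw₀₂.differentiableAt two_ne_zero
  unfold christoffelB christoffelE
  refine ⟨?_, ?_, ?_⟩
  · rw [dx_congr hV hX hz, hX hz, hY hz, dx_div (by fun_prop) (by fun_prop) hsq]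
    simp (disch := fun_prop) only [dx_sub, dx_mul, hxx, hxx₀]
    field_simp
    ring
  · rw [dx_congr hV hY hz, hX hz, hY hz, dx_div (by fun_prop) (by fun_prop) hsq]
    simp (disch := fun_prop) only [dx_sub, dx_mul, hxy, hxy₀]
    field_simp
    ring
  · rw [dy_congr hV hY hz, hX hz, hY hz, dy_div (by fun_prop) (by fun_prop) hsq]
    simp (disch := fun_prop) only [dy_sub, dy_mul, hyy, hyy₀]
    field_simp
    ring

theorem flatChristoffel_of_projectiveHessian (hg : DifferentiableAt ℝ g z)
    (hh : DifferentiableAt ℝ h z) (hw₀ : ContDiffAt ℝ 2 w₀ z) (hne : w₀ z ≠ 0)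
    (hH : ProjectiveHessian c g h d w₀ z) :
    FlatChristoffel (fun z => h z + 2 * christoffelE h w₀ z) (christoffelB g w₀) c d
      (christoffelE h w₀) (fun z => g z + 2 * christoffelB g w₀ z) z := by
  obtain ⟨hxx, hxy, hyy⟩ := hH
  rw [projectiveXX] at hxx
  rw [projectiveXY] at hxy
  rw [projectiveYY] at hyy
  have hw₀₁ := hw₀.differentiableAt two_ne_zero
  have hwx := differentiableAt_dx hw₀
  have hwy := differentiableAt_dy hw₀
  have hqx := differentiableAt_div hwx hw₀₁ hne
  have hqy := differentiableAt_div hwy hw₀₁ hne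
  have hqxx := dx_div hwx hw₀₁ hne
  have hqyx := dx_div hwy hw₀₁ hne
  have hqxy := dy_div hwx hw₀₁ hne
  have hqyy := dy_div hwy hw₀₁ hne
  rw [hxx] at hqxx
  rw [hxy] at hqyx
  rw [dy_dx_comm hw₀, hxy] at hqxy
  rw [hyy] at hqyy
  unfold christoffelB christoffelE
  refine ⟨?_, ?_, ?_, ?_⟩ <;>
    simp (disch := fun_prop) only [dx_add, dx_sub, dx_mul, dx_const, dy_add, dy_sub, dy_mul,
      dy_const, dx_div_const, dy_div_const, hqxx, hqyx, hqxy, hqyy] <;>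
    field_simp <;> ring

theorem exists_affine_coordinates (hU : IsOpen U) (hc : ContDiffOn ℝ ∞ c U)
    (hg : ContDiffOn ℝ ∞ g U) (hh : ContDiffOn ℝ ∞ h U) (hd : ContDiffOn ℝ ∞ d U)
    (hLT : ∀ z ∈ U, LieTresse c g h d z) {z₀ : ℝ × ℝ} (hz₀ : z₀ ∈ U) :
    ∃ (V : Set (ℝ × ℝ)) (b e X Y : ℝ × ℝ → ℝ), IsOpen V ∧ z₀ ∈ V ∧ V ⊆ U ∧
      ContDiffOn ℝ ∞ b V ∧ ContDiffOn ℝ ∞ e V ∧ ContDiffOn ℝ ∞ X V ∧ ContDiffOn ℝ ∞ Y V ∧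
      InjOn (fun z => (X z, Y z)) V ∧ ∀ z ∈ V, dx X z * dy Y z - dy X z * dx Y z ≠ 0 ∧
        FlatChristoffel (fun z => h z + 2 * e z) b c d e (fun z => g z + 2 * b z) z ∧
        IsAffineFunctionAt (fun z => h z + 2 * e z) b c d e (fun z => g z + 2 * b z) X z ∧
        IsAffineFunctionAt (fun z => h z + 2 * e z) b c d e (fun z => g z + 2 * b z) Y z := by
  obtain ⟨W, w, hW, hzW, hWU, hw, hjet, hH, hne⟩ :=
    exists_projectiveHessian_frame hU hc hg hh hd hLT hz₀
  have hratio (i : Fin 3) : ContDiffOn ℝ ∞ (fun z => w i z / w 0 z) W := (hw i).div (hw 0) hne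
  have hjacobian : dx (fun z => w 1 z / w 0 z) z₀ * dy (fun z => w 2 z / w 0 z) z₀
      - dy (fun z => w 1 z / w 0 z) z₀ * dx (fun z => w 2 z / w 0 z) z₀ ≠ 0 := by
    have hd' (i : Fin 3) := differentiableAt_of_contDiffOn hW (hw i) hzW
    have hjet' (i : Fin 3) : w i z₀ = Pi.single (M := fun _ => ℝ) i 1 0 ∧
        dx (w i) z₀ = Pi.single (M := fun _ => ℝ) i 1 1 ∧
        dy (w i) z₀ = Pi.single (M := fun _ => ℝ) i 1 2 :=
      ⟨congrFun (hjet i) 0, congrFun (hjet i) 1, congrFun (hjet i) 2⟩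
    simp [dx_div, dy_div, hd', hjet']
  obtain ⟨V', hV', hzV', hinj, hJ⟩ := exists_isOpen_injOn_of_jacobian_ne_zero
    ((contDiffAt_two_of_contDiffOn hW (hratio 1) hzW).of_le one_le_two)
    ((contDiffAt_two_of_contDiffOn hW (hratio 2) hzW).of_le one_le_two) hjacobian
  have hsub : W ∩ V' ⊆ W := inter_subset_left
  refine ⟨W ∩ V', christoffelB g (w 0), christoffelE h (w 0), _, _, hW.inter hV', ⟨hzW, hzV'⟩,
    hsub.trans hWU, (contDiffOn_christoffelB hW (hg.mono hWU) (hw 0) hne).mono hsub,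
    (contDiffOn_christoffelE hW (hh.mono hWU) (hw 0) hne).mono hsub, (hratio 1).mono hsub,
    (hratio 2).mono hsub, hinj.mono inter_subset_right, fun z hz => ⟨hJ z hz.2, ?_, ?_, ?_⟩⟩
  · exact flatChristoffel_of_projectiveHessian (differentiableAt_of_contDiffOn hU hg (hWU hz.1))
      (differentiableAt_of_contDiffOn hU hh (hWU hz.1))
      (contDiffAt_two_of_contDiffOn hW (hw 0) hz.1) (hne z hz.1) (hH z hz.1 0)
  · exact isAffineFunctionAt_div hW (hw 1) (hw 0) hne hz.1 (hH z hz.1 1) (hH z hz.1 0)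
  · exact isAffineFunctionAt_div hW (hw 2) (hw 0) hne hz.1 (hH z hz.1 2) (hH z hz.1 0)

theorem metricCompatible_of_isAffineFunctionAt (hX : ContDiffAt ℝ 2 X z) (hY : ContDiffAt ℝ 2 Y z)
    (hJ : dx X z * dy Y z - dy X z * dx Y z ≠ 0) (hXa : IsAffineFunctionAt a b c d e f X z)
    (hYa : IsAffineFunctionAt a b c d e f Y z) :
    MetricCompatible a b c d e f (fun z => dx X z * dx X z + dx Y z * dx Y z)
      (fun z => dx X z * dy X z + dx Y z * dy Y z)
      (fun z => dy X z * dy X z + dy Y z * dy Y z) z := by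
  obtain ⟨hXxx, hXxy, hXyy⟩ := hXa
  obtain ⟨hYxx, hYxy, hYyy⟩ := hYa
  have hdet : (dx X z * dx X z + dx Y z * dx Y z) * (dy X z * dy X z + dy Y z * dy Y z)
      - (dx X z * dy X z + dx Y z * dy Y z) ^ 2 = (dx X z * dy Y z - dy X z * dx Y z) ^ 2 := by
    ring
  refine ⟨hdet.trans_ne (pow_ne_zero 2 hJ), ?_, ?_, ?_, ?_, ?_, ?_⟩ <;>
    simp (disch := fun_prop) only [dx_add, dx_mul, dy_add, dy_mul, dy_dx_comm hX, dy_dx_comm hY,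
      hXxx, hXxy, hXyy, hYxx, hYxy, hYyy] <;>
    ring

theorem hasFlatMetricAt_of_lieTresse (hU : IsOpen U) (hc : ContDiffOn ℝ ∞ c U)
    (hg : ContDiffOn ℝ ∞ g U) (hh : ContDiffOn ℝ ∞ h U) (hd : ContDiffOn ℝ ∞ d U)
    (hLT : ∀ z ∈ U, LieTresse c g h d z) {z₀ : ℝ × ℝ} (hz₀ : z₀ ∈ U) :
    HasFlatMetricAt U c g h d z₀ := by
  obtain ⟨V, b, e, X, Y, hV, hzV, hVU, hb, he, hX, hY, -, hall⟩ :=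
    exists_affine_coordinates hU hc hg hh hd hLT hz₀
  have hXx := contDiffOn_dx hV hX
  have hXy := contDiffOn_dy hV hX
  have hYx := contDiffOn_dx hV hY
  have hYy := contDiffOn_dy hV hY
  refine ⟨V, fun z => h z + 2 * e z, b, e, fun z => g z + 2 * b z, _, _, _, hV, hzV, hVU,
    (hh.mono hVU).add (contDiffOn_const.mul he), hb, he,
    (hg.mono hVU).add (contDiffOn_const.mul hb), (hXx.mul hXx).add (hYx.mul hYx),
    (hXx.mul hXy).add (hYx.mul hYy), (hXy.mul hXy).add (hYy.mul hYy), fun z hz => ?_⟩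
  obtain ⟨hJ, hflat, hXa, hYa⟩ := hall z hz
  exact ⟨by ring, by ring, hflat, metricCompatible_of_isAffineFunctionAt
    (contDiffAt_two_of_contDiffOn hV hX hz) (contDiffAt_two_of_contDiffOn hV hY hz) hJ hXa hYa⟩

theorem deriv_newFirst {p : ℝ} (hp : slopeDeriv X z p ≠ 0) :
    deriv (newFirst X Y z) p = (dy Y z * slopeDeriv X z p - slopeDeriv Y z p * dy X z)
      / slopeDeriv X z p ^ 2 := by
  have hslope (Z : ℝ × ℝ → ℝ) : HasDerivAt (slopeDeriv Z z) (dy Z z) p :=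
    (hasDerivAt_mul_const (dy Z z)).const_add (dx Z z)
  exact ((hslope Y).fun_div (hslope X) hp).deriv

theorem newSecond_eq_of_isAffineFunctionAt (hX : ContDiffAt ℝ 2 X z) (hY : ContDiffAt ℝ 2 Y z)
    (hXa : IsAffineFunctionAt a b c d e f X z) (hYa : IsAffineFunctionAt a b c d e f Y z)
    {p : ℝ} (hp : slopeDeriv X z p ≠ 0) (q : ℝ) :
    newSecond X Y z p q = (dx X z * dy Y z - dy X z * dx Y z) *
      (q - rootRHS c (fun z => f z - 2 * b z) (fun z => a z - 2 * e z) d z p)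
        / slopeDeriv X z p ^ 3 := by
  obtain ⟨hXxx, hXxy, hXyy⟩ := hXa
  obtain ⟨hYxx, hYxy, hYyy⟩ := hYa
  rw [newSecond, totalDeriv, deriv_newFirst hp]
  unfold newFirst rootRHS
  rw [slopeDeriv] at hp
  unfold slopeDeriv
  rw [dx_div (by fun_prop) (by fun_prop) hp, dy_div (by fun_prop) (by fun_prop) hp]
  simp (disch := fun_prop) only [dx_add, dx_mul, dx_const, dy_add, dy_mul, dy_const,
    dy_dx_comm hX, dy_dx_comm hY, hXxx, hXxy, hXyy, hYxx, hYxy, hYyy]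
  field_simp
  ring

theorem linearizableAt_of_lieTresse (hU : IsOpen U) (hc : ContDiffOn ℝ ∞ c U)
    (hg : ContDiffOn ℝ ∞ g U) (hh : ContDiffOn ℝ ∞ h U) (hd : ContDiffOn ℝ ∞ d U)
    (hLT : ∀ z ∈ U, LieTresse c g h d z) {z₀ : ℝ × ℝ} (hz₀ : z₀ ∈ U) :
    LinearizableAt U (rootRHS c g h d) z₀ := by
  obtain ⟨V, b, e, X, Y, hV, hzV, hVU, -, -, hX, hY, hinj, hall⟩ :=
    exists_affine_coordinates hU hc hg hh hd hLT hz₀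
  refine ⟨V, X, Y, hV, hzV, hVU, hX, hY, hinj, fun z hz => (hall z hz).1,
    fun z hz p q hp => ?_⟩
  obtain ⟨hJ, -, hXa, hYa⟩ := hall z hz
  rw [newSecond_eq_of_isAffineFunctionAt (contDiffAt_two_of_contDiffOn hV hX hz)
    (contDiffAt_two_of_contDiffOn hV hY hz) hXa hYa hp q, div_eq_zero_iff,
    or_iff_left (pow_ne_zero 3 hp), mul_eq_zero, or_iff_right hJ, sub_eq_zero]
  simp only [rootRHS, add_sub_cancel_right]

end AffineCoordinates

/-! ### Functions of `(x, y)` and `y'` -/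

section TotalDerivative

variable {F Q : ℝ × ℝ → ℝ → ℝ} {U : Set (ℝ × ℝ)} {I : Set ℝ} {y : ℝ → ℝ}

theorem totalDeriv_eq_fderiv {z : ℝ × ℝ} {p : ℝ}
    (hF : DifferentiableAt ℝ (Function.uncurry F) (z, p)) (q : ℝ) :
    totalDeriv F z p q = fderiv ℝ (Function.uncurry F) (z, p) ((1, p), q) := by
  have hpoint : HasFDerivAt (fun w => F w p) (fderiv ℝ (Function.uncurry F) (z, p) ∘L
      ContinuousLinearMap.inl ℝ (ℝ × ℝ) ℝ) z :=
    HasFDerivAt.comp (g := Function.uncurry F) (f := fun w => (w, p)) z hF.hasFDerivAt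
      (hasFDerivAt_prodMk_left z p)
  have hslope : HasDerivAt (F z) (fderiv ℝ (Function.uncurry F) (z, p) (0, 1)) p :=
    hF.hasFDerivAt.comp_hasDerivAt p ((hasDerivAt_const p z).prodMk (hasDerivAt_id p))
  have hsplit : (((1, p), q) : (ℝ × ℝ) × ℝ) = ((1, 0), 0) + p • ((0, 1), 0) + q • (0, 1) := by
    ext <;> simp
  rw [totalDeriv, dx, dy, hpoint.fderiv, hslope.deriv, hsplit, map_add, map_add, map_smul,
    map_smul]
  simp

theorem hasDerivAt_along_curve {x : ℝ}
    (hF : DifferentiableAt ℝ (Function.uncurry F) ((x, y x), deriv y x))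
    (hy : DifferentiableAt ℝ y x) (hy' : DifferentiableAt ℝ (deriv y) x) :
    HasDerivAt (fun t => F (t, y t) (deriv y t))
      (totalDeriv F (x, y x) (deriv y x) (deriv (deriv y) x)) x := by
  rw [totalDeriv_eq_fderiv hF]
  exact hF.hasFDerivAt.comp_hasDerivAt x
    (((hasDerivAt_id x).prodMk hy.hasDerivAt).prodMk hy'.hasDerivAt)

theorem contDiffOn_uncurry_totalDerivAlong (hU : IsOpen U)
    (hQ : ContDiffOn ℝ ∞ (Function.uncurry Q) (U ×ˢ univ))
    (hF : ContDiffOn ℝ ∞ (Function.uncurry F) (U ×ˢ univ)) :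
    ContDiffOn ℝ ∞ (Function.uncurry (totalDerivAlong Q F)) (U ×ˢ univ) := by
  have hopen : IsOpen (U ×ˢ (univ : Set ℝ)) := hU.prod isOpen_univ
  have hdirection : ContDiffOn ℝ ∞ (fun w : (ℝ × ℝ) × ℝ =>
      (((1 : ℝ), w.2), Function.uncurry Q w)) (U ×ˢ univ) :=
    (contDiffOn_const.prodMk contDiffOn_snd).prodMk hQ
  exact (((contDiffOn_infty_iff_fderiv_of_isOpen hopen).1 hF).2.clm_apply hdirection).congr
    fun w hw => totalDeriv_eq_fderiv (differentiableAt_of_contDiffOn hopen hF hw) _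

theorem IsSolution.deriv_deriv_eq (hy : IsSolution 2 U Q I y) {x : ℝ} (hx : x ∈ I) :
    deriv (deriv y) x = Q (x, y x) (deriv y x) := by
  rw [← (hy.2.2 x hx).2, iteratedDeriv_succ, iteratedDeriv_one]

theorem IsSolution.contDiffOn (hy : IsSolution 2 U Q I y)
    (hQ : ContDiffOn ℝ ∞ (Function.uncurry Q) (U ×ˢ univ)) : ContDiffOn ℝ ∞ y I := by
  have hsucc {n : ℕ} {u : ℝ → ℝ} : ContDiffOn ℝ ((n + 1 : ℕ) : WithTop ℕ∞) u I ↔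
      DifferentiableOn ℝ u I ∧ ContDiffOn ℝ n (deriv u) I := by
    rw [Nat.cast_succ, contDiffOn_succ_iff_deriv_of_isOpen hy.1]
    simp
  have hbootstrap (n : ℕ) : ContDiffOn ℝ ((n + 2 : ℕ) : WithTop ℕ∞) y I := by
    induction n with
    | zero => exact hy.2.1
    | succ n ih =>
      obtain ⟨hdiff, hderiv⟩ := hsucc.1 ih
      have hjet : ContDiffOn ℝ ((n + 1 : ℕ) : WithTop ℕ∞) (fun x => ((x, y x), deriv y x)) I :=
        (contDiffOn_id.prodMk (ih.of_le (by exact_mod_cast Nat.le_succ _))).prodMk hderiv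
      have hQjet : ContDiffOn ℝ ((n + 1 : ℕ) : WithTop ℕ∞)
          (fun x => Q (x, y x) (deriv y x)) I :=
        (contDiffOn_infty.1 hQ (n + 1)).comp hjet fun x hx => ⟨(hy.2.2 x hx).1, mem_univ _⟩
      exact hsucc.2 ⟨hdiff, hsucc.2 ⟨(hsucc.1 hderiv).1,
        hQjet.congr fun x hx => hy.deriv_deriv_eq hx⟩⟩
  exact contDiffOn_infty.2 fun n => (hbootstrap n).of_le (by exact_mod_cast Nat.le_add_right n 2)

theorem IsSolution.iteratedDeriv_succ_eq (hy : IsSolution 2 U Q I y) (hU : IsOpen U)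
    (hQ : ContDiffOn ℝ ∞ (Function.uncurry Q) (U ×ˢ univ))
    (hF : ContDiffOn ℝ ∞ (Function.uncurry F) (U ×ˢ univ)) {k : ℕ}
    (hk : EqOn (iteratedDeriv k y) (fun x => F (x, y x) (deriv y x)) I) :
    EqOn (iteratedDeriv (k + 1) y) (fun x => totalDerivAlong Q F (x, y x) (deriv y x)) I := by
  intro x hx
  have hyc := hy.contDiffOn hQ
  have hy'c := ((contDiffOn_infty_iff_deriv_of_isOpen hy.1).1 hyc).2
  have hFx := differentiableAt_of_contDiffOn (hU.prod isOpen_univ) hF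
    (mk_mem_prod (hy.2.2 x hx).1 (mem_univ (deriv y x)))
  rw [iteratedDeriv_succ, (hk.eventuallyEq_of_mem (hy.1.mem_nhds hx)).deriv_eq,
    (hasDerivAt_along_curve hFx (differentiableAt_of_contDiffOn hy.1 hyc hx)
      (differentiableAt_of_contDiffOn hy.1 hy'c hx)).deriv, hy.deriv_deriv_eq hx]
  rfl

theorem IsSolution.four_of_two (hy : IsSolution 2 U Q I y) (hU : IsOpen U)
    (hQ : ContDiffOn ℝ ∞ (Function.uncurry Q) (U ×ˢ univ)) :
    IsSolution 4 U (totalDerivAlong Q (totalDerivAlong Q Q)) I y := by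
  have hthird := hy.iteratedDeriv_succ_eq hU hQ hQ fun x hx => (hy.2.2 x hx).2
  have hfourth := hy.iteratedDeriv_succ_eq hU hQ
    (contDiffOn_uncurry_totalDerivAlong hU hQ hQ) hthird
  exact ⟨hy.1, contDiffOn_infty.1 (hy.contDiffOn hQ) 4,
    fun x hx => ⟨(hy.2.2 x hx).1, hfourth hx⟩⟩

theorem IsSolution.congr {n : ℕ} (hy : IsSolution n U Q I y)
    (h : ∀ z ∈ U, ∀ p, F z p = Q z p) : IsSolution n U F I y :=
  ⟨hy.1, hy.2.1, fun x hx => ⟨(hy.2.2 x hx).1,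
    (hy.2.2 x hx).2.trans (h _ (hy.2.2 x hx).1 _).symm⟩⟩

end TotalDerivative

/-! ### Exact equations -/

section ExactEquations

variable {A : Type*} [NormedAddCommGroup A] [NormedSpace ℝ A] {f : A × ℝ → ℝ} {S : Set A} {k : ℝ}

theorem eq_add_mul_of_vertical_fderiv_eq_const (hS : IsOpen S)
    (hf : DifferentiableOn ℝ f (S ×ˢ univ))
    (hk : ∀ a ∈ S, ∀ t, fderiv ℝ f (a, t) (0, 1) = k) {a : A} (ha : a ∈ S) (t : ℝ) :
    f (a, t) = f (a, 0) + k * t := by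
  have hderiv (t : ℝ) : HasDerivAt (fun t => f (a, t) - k * t) 0 t := by
    have hfat := hf.differentiableAt ((hS.prod isOpen_univ).mem_nhds (mk_mem_prod ha (mem_univ t)))
    have hline : HasDerivAt (fun t => f (a, t)) (fderiv ℝ f (a, t) (0, 1)) t :=
      hfat.hasFDerivAt.comp_hasDerivAt t ((hasDerivAt_const t a).prodMk (hasDerivAt_id t))
    rw [hk a ha t] at hline
    simpa using hline.fun_sub ((hasDerivAt_id' t).const_mul k)
  have hconst := is_const_of_deriv_eq_zero (fun t => (hderiv t).differentiableAt)
    (fun t => (hderiv t).deriv) t 0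
  linear_combination hconst

theorem fderiv_slice_of_fderiv_eq_affine (hS : IsOpen S) (hf : DifferentiableOn ℝ f (S ×ˢ univ))
    {v : A → ℝ → A} {H : A → ℝ → ℝ}
    (hH : ∀ a ∈ S, ∀ t s, fderiv ℝ f (a, t) (v a t, s) = k * s + H a t) :
    DifferentiableOn ℝ (fun a => f (a, 0)) S ∧
      ∀ a ∈ S, ∀ t, fderiv ℝ (fun a => f (a, 0)) a (v a t) = H a t := by
  have hopen : IsOpen (S ×ˢ (univ : Set ℝ)) := hS.prod isOpen_univ
  have hslice (a : A) (ha : a ∈ S) : DifferentiableAt ℝ (fun a => f (a, 0)) a :=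
    (hf.differentiableAt (hopen.mem_nhds (mk_mem_prod ha (mem_univ 0)))).comp a
      (differentiableAt_id.prodMk (differentiableAt_const _))
  have hvertical : ∀ a ∈ S, ∀ t, fderiv ℝ f (a, t) (0, 1) = k := fun a ha t => by
    rw [show ((0, 1) : A × ℝ) = (v a t, 1) - (v a t, 0) by simp, map_sub, hH a ha, hH a ha]
    ring
  refine ⟨fun a ha => (hslice a ha).differentiableWithinAt, fun a ha t => ?_⟩
  have heq : f =ᶠ[𝓝 (a, t)] fun w => f (w.1, 0) + k * w.2 := by
    filter_upwards [hopen.mem_nhds (mk_mem_prod ha (mem_univ t))] with w hw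
    exact eq_add_mul_of_vertical_fderiv_eq_const hS hf hvertical hw.1 w.2
  have hfst : HasFDerivAt (fun w : A × ℝ => f (w.1, 0))
      (fderiv ℝ (fun a => f (a, 0)) a ∘L ContinuousLinearMap.fst ℝ A ℝ) (a, t) :=
    HasFDerivAt.comp (g := fun a => f (a, 0)) (f := Prod.fst) (a, t) (hslice a ha).hasFDerivAt
      hasFDerivAt_fst
  have hat := hH a ha t 0
  rw [heq.fderiv_eq, (hfst.fun_add (hasFDerivAt_snd.const_mul k)).fderiv] at hat
  simpa using hat

variable {V : Set (ℝ × ℝ)} {G : ℝ × ℝ → ℝ → ℝ}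

/-- The identification of nested pairs `((((x, y), p), q), r)` with the tuples `(x, y, p, q, r)` of
`IsTotalDerivativeOn`; nested pairs let the derivatives of highest order be dropped one by one. -/
def jetAssoc : (((ℝ × ℝ) × ℝ) × ℝ) × ℝ →L[ℝ] ℝ × ℝ × ℝ × ℝ × ℝ :=
  ((ContinuousLinearEquiv.prodAssoc ℝ ((ℝ × ℝ) × ℝ) ℝ ℝ).trans <|
    (ContinuousLinearEquiv.prodAssoc ℝ (ℝ × ℝ) ℝ (ℝ × ℝ)).trans <|
      ContinuousLinearEquiv.prodAssoc ℝ ℝ ℝ (ℝ × ℝ × ℝ) :)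

theorem IsTotalDerivativeOn.exists_nested (hV : IsOpen V) (h : IsTotalDerivativeOn V G) :
    ∃ Ψ : (((ℝ × ℝ) × ℝ) × ℝ) × ℝ → ℝ,
      DifferentiableOn ℝ Ψ (((V ×ˢ univ) ×ˢ univ) ×ˢ univ) ∧
      ∀ z ∈ V, ∀ p q r s,
        fderiv ℝ Ψ (((z, p), q), r) ((((1, p), q), r), s) = s + G z p := by
  obtain ⟨Φ, hΦ, hG⟩ := h
  have hopen : IsOpen {w : ℝ × ℝ × ℝ × ℝ × ℝ | (w.1, w.2.1) ∈ V} :=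
    hV.preimage (by fun_prop : Continuous fun w : ℝ × ℝ × ℝ × ℝ × ℝ => (w.1, w.2.1))
  refine ⟨Φ ∘ jetAssoc, hΦ.comp jetAssoc.differentiable.differentiableOn fun w hw => hw.1.1.1, ?_⟩
  rintro ⟨x, y⟩ hz p q r s
  have hat : DifferentiableAt ℝ Φ (jetAssoc ((((x, y), p), q), r)) :=
    hΦ.differentiableAt (hopen.mem_nhds hz)
  rw [fderiv_comp _ hat jetAssoc.differentiableAt, jetAssoc.fderiv]
  exact hG x y p q r s hz

theorem IsTotalDerivativeOn.affine (hV : IsOpen V) (h : IsTotalDerivativeOn V G) {z : ℝ × ℝ}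
    (hz : z ∈ V) (p : ℝ) : G z p = G z 0 + p * (G z 1 - G z 0) := by
  obtain ⟨Ψ₃, hdiff₃, hΨ₃⟩ := h.exists_nested hV
  have hV₁ : IsOpen (V ×ˢ (univ : Set ℝ)) := hV.prod isOpen_univ
  have hV₂ : IsOpen ((V ×ˢ (univ : Set ℝ)) ×ˢ (univ : Set ℝ)) := hV₁.prod isOpen_univ
  -- `dΦ/dx` is affine in the highest derivative, so `Φ` is affine in `y'''`; the part of `Φ` free
  -- of `y'''` is then independent of `y''`, and after that of `y'`.
  obtain ⟨hdiff₂, hΨ₂⟩ := fderiv_slice_of_fderiv_eq_affine (k := 1)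
    (v := fun a r => (((1, a.1.2), a.2), r)) (H := fun a _ => G a.1.1 a.1.2) hV₂ hdiff₃
    fun a ha r s => by rw [hΨ₃ a.1.1 ha.1.1, one_mul]
  obtain ⟨hdiff₁, hΨ₁⟩ := fderiv_slice_of_fderiv_eq_affine (k := 0)
    (v := fun a q => ((1, a.2), q)) (H := fun a _ => G a.1 a.2) hV₁ hdiff₂
    fun a ha q r => by rw [hΨ₂ (a, q) ⟨ha, mem_univ q⟩ r, zero_mul, zero_add]
  obtain ⟨-, hΨ₀⟩ := fderiv_slice_of_fderiv_eq_affine (k := 0)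
    (v := fun _ p => (1, p)) (H := G) hV hdiff₁
    fun z hz p q => by rw [hΨ₁ (z, p) ⟨hz, mem_univ p⟩ q, zero_mul, zero_add]
  have hslope : ((1, p) : ℝ × ℝ) = (1, 0) + p • ((1, 1) - (1, 0)) := by ext <;> simp
  rw [← hΨ₀ z hz p, hslope, map_add, map_smul, map_sub, hΨ₀ z hz, hΨ₀ z hz, smul_eq_mul]

theorem not_isTotalDerivativeOn_septic (hV : IsOpen V) {P : Fin 8 → ℝ × ℝ → ℝ} {z : ℝ × ℝ}
    (hz : z ∈ V) (h7 : P 7 z ≠ 0) : ¬ IsTotalDerivativeOn V (septic P) := by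
  intro h
  have haff := h.affine hV hz
  simp only [septic] at haff
  exact h7 (by linarith [haff 2, haff 3, haff 4, haff 5, haff 6, haff 7])

end ExactEquations

/-! ### The equation obtained from the root equation -/

section RootEquation

variable {U : Set (ℝ × ℝ)} {c g h d : ℝ × ℝ → ℝ} {z : ℝ × ℝ}

theorem contDiffOn_uncurry_rootRHS (hc : ContDiffOn ℝ ∞ c U) (hg : ContDiffOn ℝ ∞ g U)
    (hh : ContDiffOn ℝ ∞ h U) (hd : ContDiffOn ℝ ∞ d U) :
    ContDiffOn ℝ ∞ (Function.uncurry (rootRHS c g h d)) (U ×ˢ univ) := by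
  have hfst {f : ℝ × ℝ → ℝ} (hf : ContDiffOn ℝ ∞ f U) :
      ContDiffOn ℝ ∞ (fun w : (ℝ × ℝ) × ℝ => f w.1) (U ×ˢ univ) :=
    hf.comp contDiffOn_fst fun w hw => hw.1
  have hsnd : ContDiffOn ℝ ∞ (fun w : (ℝ × ℝ) × ℝ => w.2) (U ×ˢ univ) := contDiffOn_snd
  exact ((((hfst hc).neg.mul (hsnd.pow 3)).add ((hfst hg).mul (hsnd.pow 2))).sub
    ((hfst hh).mul hsnd)).add (hfst hd)

theorem deriv_quintic (a₅ a₄ a₃ a₂ a₁ a₀ p : ℝ) :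
    deriv (fun p => a₅ * p ^ 5 + a₄ * p ^ 4 + a₃ * p ^ 3 + a₂ * p ^ 2 + a₁ * p + a₀) p =
      5 * a₅ * p ^ 4 + 4 * a₄ * p ^ 3 + 3 * a₃ * p ^ 2 + 2 * a₂ * p + a₁ := by
  simp (disch := fun_prop) only [deriv_fun_add, deriv_const_mul_field, deriv_pow_field,
    deriv_const]
  norm_num
  ring

theorem deriv_rootRHS (p : ℝ) :
    deriv (rootRHS c g h d z) p = -(3 * c z * p ^ 2) + 2 * g z * p - h z := by
  have hquintic : rootRHS c g h d z =
      fun p => 0 * p ^ 5 + 0 * p ^ 4 + -(c z) * p ^ 3 + g z * p ^ 2 + -(h z) * p + d z := by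
    funext p
    rw [rootRHS]
    ring
  rw [hquintic, deriv_quintic]
  ring

theorem totalDerivAlong_rootRHS (hc : DifferentiableAt ℝ c z) (hg : DifferentiableAt ℝ g z)
    (hh : DifferentiableAt ℝ h z) (hd : DifferentiableAt ℝ d z) (p : ℝ) :
    totalDerivAlong (rootRHS c g h d) (rootRHS c g h d) z p =
      3 * (c z * c z) * p ^ 5 + (-(dy c z) - 5 * (c z * g z)) * p ^ 4
        + (-(dx c z) + dy g z + 4 * (c z * h z) + 2 * (g z * g z)) * p ^ 3
        + (dx g z - dy h z - 3 * (g z * h z) - 3 * (c z * d z)) * p ^ 2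
        + (-(dx h z) + dy d z + h z * h z + 2 * (d z * g z)) * p + (dx d z - d z * h z) := by
  rw [totalDerivAlong, totalDeriv, deriv_rootRHS]
  unfold rootRHS
  simp (disch := fun_prop) only [dx_add, dx_sub, dx_mul, dx_neg, dx_const, dy_add, dy_sub, dy_mul,
    dy_neg, dy_const]
  ring

theorem totalDerivAlong_totalDerivAlong_rootRHS (hU : IsOpen U) (hc : ContDiffOn ℝ ∞ c U)
    (hg : ContDiffOn ℝ ∞ g U) (hh : ContDiffOn ℝ ∞ h U) (hd : ContDiffOn ℝ ∞ d U) (hz : z ∈ U)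
    {P : Fin 8 → ℝ × ℝ → ℝ} (h7 : P 7 z = 15 * c z ^ 3)
    (h6 : P 6 z = 35 * c z ^ 2 * g z + 10 * c z * dy c z)
    (h5 : P 5 z = 27 * c z ^ 2 * h z + 26 * g z ^ 2 * c z - 9 * c z * dx c z
      + 9 * g z * dy c z + 8 * c z * dy g z + dy (dy c) z)
    (h4 : P 4 z = 21 * c z ^ 2 * d z + 38 * g z * h z * c z + 6 * g z ^ 3 - 8 * g z * dx c z
      + 8 * h z * dy c z - 7 * c z * dx g z + 7 * g z * dy g z + 6 * c z * dy h z
      - 2 * dx (dy c) z + dy (dy g) z)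
    (hcon : Constraints P c g h d z) (p : ℝ) :
    -septic P z p = totalDerivAlong (rootRHS c g h d)
      (totalDerivAlong (rootRHS c g h d) (rootRHS c g h d)) z p := by
  obtain ⟨h3, h2, h1, h0⟩ := hcon
  have hquintic (w : ℝ × ℝ) (hw : w ∈ U) := totalDerivAlong_rootRHS
    (differentiableAt_of_contDiffOn hU hc hw) (differentiableAt_of_contDiffOn hU hg hw)
    (differentiableAt_of_contDiffOn hU hh hw) (differentiableAt_of_contDiffOn hU hd hw)
  have hc₂ := contDiffAt_two_of_contDiffOn hU hc hz
  have hg₂ := contDiffAt_two_of_contDiffOn hU hg hz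
  have hh₂ := contDiffAt_two_of_contDiffOn hU hh hz
  have hd₂ := contDiffAt_two_of_contDiffOn hU hd hz
  have hc₁ := hc₂.differentiableAt two_ne_zero
  have hg₁ := hg₂.differentiableAt two_ne_zero
  have hh₁ := hh₂.differentiableAt two_ne_zero
  have hd₁ := hd₂.differentiableAt two_ne_zero
  rw [totalDerivAlong, totalDeriv, funext (hquintic z hz), deriv_quintic,
    dx_congr hU (fun w hw => hquintic w hw p) hz, dy_congr hU (fun w hw => hquintic w hw p) hz]
  simp (disch := fun_prop) only [dx_add, dx_sub, dx_mul, dx_neg, dx_const, dy_add, dy_sub, dy_mul,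
    dy_neg, dy_const, dy_dx_comm hc₂, dy_dx_comm hg₂, dy_dx_comm hh₂, dy_dx_comm hd₂]
  simp only [septic, rootRHS, h7, h6, h5, h4, h3, h2, h1, h0]
  ring

theorem conditionallyLinearizable_of_lieTresse (hU : IsOpen U) (hc : ContDiffOn ℝ ∞ c U)
    (hg : ContDiffOn ℝ ∞ g U) (hh : ContDiffOn ℝ ∞ h U) (hd : ContDiffOn ℝ ∞ d U)
    (hLT : ∀ z ∈ U, LieTresse c g h d z) {F : ℝ × ℝ → ℝ → ℝ}
    (hF : ∀ z ∈ U, ∀ p, F z p = totalDerivAlong (rootRHS c g h d)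
      (totalDerivAlong (rootRHS c g h d) (rootRHS c g h d)) z p) :
    ConditionallyLinearizable U F (rootRHS c g h d) :=
  ⟨hF, fun _ _ hy => (hy.four_of_two hU (contDiffOn_uncurry_rootRHS hc hg hh hd)).congr hF,
    fun _ hz => linearizableAt_of_lieTresse hU hc hg hh hd hLT hz⟩

end RootEquation

/-! ### The coefficients of the root equation -/

section Coefficients

theorem cbrt_pow_three (t : ℝ) : cbrt t ^ 3 = t := by
  have habs : (|t| ^ (1 / 3 : ℝ)) ^ 3 = |t| := by
    rw [← Real.rpow_natCast, ← Real.rpow_mul (abs_nonneg t)]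
    norm_num
  rcases lt_trichotomy t 0 with ht | rfl | ht
  · rw [cbrt, mul_pow, habs, Real.sign_of_neg ht, abs_of_neg ht]
    ring
  · simp [cbrt]
  · rw [cbrt, mul_pow, habs, Real.sign_of_pos ht, abs_of_pos ht]
    ring

theorem contDiffAt_cbrt {t : ℝ} (ht : t ≠ 0) : ContDiffAt ℝ ∞ cbrt t := by
  rcases lt_or_gt_of_ne ht with hneg | hpos
  · refine (contDiffAt_id.neg.rpow_const_of_ne
      (p := (1 / 3 : ℝ)) (neg_ne_zero.2 ht)).neg.congr_of_eventuallyEq ?_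
    filter_upwards [eventually_lt_nhds hneg] with s hs
    simp [cbrt, Real.sign_of_neg hs, abs_of_neg hs]
  · refine (contDiffAt_id.rpow_const_of_ne (p := (1 / 3 : ℝ)) ht).congr_of_eventuallyEq ?_
    filter_upwards [eventually_gt_nhds hpos] with s hs
    simp [cbrt, Real.sign_of_pos hs, abs_of_pos hs]

variable {U : Set (ℝ × ℝ)} {P : Fin 8 → ℝ × ℝ → ℝ} {z : ℝ × ℝ}

theorem coeff_seven_eq (P : Fin 8 → ℝ × ℝ → ℝ) (z : ℝ × ℝ) : P 7 z = 15 * coeffC P z ^ 3 := by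
  rw [coeffC, cbrt_pow_three]
  ring

theorem coeff_six_eq (hc : coeffC P z ≠ 0) :
    P 6 z = 35 * coeffC P z ^ 2 * coeffG P z + 10 * coeffC P z * dy (coeffC P) z := by
  simp only [coeffG]
  field_simp
  ring

theorem coeff_five_eq (hc : coeffC P z ≠ 0) :
    P 5 z = 27 * coeffC P z ^ 2 * coeffH P z + 26 * coeffG P z ^ 2 * coeffC P z
      - 9 * coeffC P z * dx (coeffC P) z + 9 * coeffG P z * dy (coeffC P) z
      + 8 * coeffC P z * dy (coeffG P) z + dy (dy (coeffC P)) z := by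
  simp only [coeffH]
  field_simp
  ring

theorem coeff_four_eq (hc : coeffC P z ≠ 0) :
    P 4 z = 21 * coeffC P z ^ 2 * coeffD P z + 38 * coeffG P z * coeffH P z * coeffC P z
      + 6 * coeffG P z ^ 3 - 8 * coeffG P z * dx (coeffC P) z + 8 * coeffH P z * dy (coeffC P) z
      - 7 * coeffC P z * dx (coeffG P) z + 7 * coeffG P z * dy (coeffG P) z
      + 6 * coeffC P z * dy (coeffH P) z - 2 * dx (dy (coeffC P)) z + dy (dy (coeffG P)) z := by
  simp only [coeffD]
  field_simp
  ring

theorem contDiffOn_coeffC (hP : ContDiffOn ℝ ∞ (P 7) U) (hc : ∀ z ∈ U, coeffC P z ≠ 0) :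
    ContDiffOn ℝ ∞ (coeffC P) U := by
  intro z hz
  have h7 : P 7 z / 15 ≠ 0 := fun h => hc z hz (by simp [coeffC, h, cbrt])
  exact (contDiffAt_cbrt h7).comp_contDiffWithinAt z (hP.div_const 15 z hz)

theorem contDiffOn_coeffG (hU : IsOpen U) (hP : ∀ i, ContDiffOn ℝ ∞ (P i) U)
    (hc : ∀ z ∈ U, coeffC P z ≠ 0) : ContDiffOn ℝ ∞ (coeffG P) U := by
  have hC := contDiffOn_coeffC (hP 7) hc
  have hP6 := hP 6
  unfold coeffG
  fun_prop (disch := simpa using hc)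

theorem contDiffOn_coeffH (hU : IsOpen U) (hP : ∀ i, ContDiffOn ℝ ∞ (P i) U)
    (hc : ∀ z ∈ U, coeffC P z ≠ 0) : ContDiffOn ℝ ∞ (coeffH P) U := by
  have hC := contDiffOn_coeffC (hP 7) hc
  have hG := contDiffOn_coeffG hU hP hc
  have hP5 := hP 5
  unfold coeffH
  fun_prop (disch := simpa using hc)

theorem contDiffOn_coeffD (hU : IsOpen U) (hP : ∀ i, ContDiffOn ℝ ∞ (P i) U)
    (hc : ∀ z ∈ U, coeffC P z ≠ 0) : ContDiffOn ℝ ∞ (coeffD P) U := by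
  have hC := contDiffOn_coeffC (hP 7) hc
  have hG := contDiffOn_coeffG hU hP hc
  have hH := contDiffOn_coeffH hU hP hc
  have hP4 := hP 4
  unfold coeffD
  fun_prop (disch := simpa using hc)

end Coefficients

end CondLin

end

theorem theorem1 (U : Set (ℝ × ℝ)) (hU : IsOpen U) (P : Fin 8 → ℝ × ℝ → ℝ)
    (hP : ∀ i, ContDiffOn ℝ ∞ (P i) U)
    (hc : ∀ z ∈ U, CondLin.coeffC P z ≠ 0)
    (hconstraints : ∀ z ∈ U, CondLin.Constraints P (CondLin.coeffC P) (CondLin.coeffG P)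
      (CondLin.coeffH P) (CondLin.coeffD P) z)
    (hLieTresse : ∀ z ∈ U, CondLin.LieTresse (CondLin.coeffC P) (CondLin.coeffG P)
      (CondLin.coeffH P) (CondLin.coeffD P) z) :
    CondLin.ConditionallyLinearizable U (fun z p => -CondLin.septic P z p)
      (CondLin.rootRHS (CondLin.coeffC P) (CondLin.coeffG P)
        (CondLin.coeffH P) (CondLin.coeffD P)) ∧
    (∀ V ⊆ U, IsOpen V → V.Nonempty →
      ¬ CondLin.IsTotalDerivativeOn V (CondLin.septic P)) ∧
    (∀ z ∈ U, CondLin.HasFlatMetricAt U (CondLin.coeffC P) (CondLin.coeffG P)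
      (CondLin.coeffH P) (CondLin.coeffD P) z) := by
  have hC := CondLin.contDiffOn_coeffC (hP 7) hc
  have hG := CondLin.contDiffOn_coeffG hU hP hc
  have hH := CondLin.contDiffOn_coeffH hU hP hc
  have hD := CondLin.contDiffOn_coeffD hU hP hc
  refine ⟨CondLin.conditionallyLinearizable_of_lieTresse hU hC hG hH hD hLieTresse
    fun z hz p => ?_, fun V hVU hV ⟨z, hz⟩ => ?_,
    fun z hz => CondLin.hasFlatMetricAt_of_lieTresse hU hC hG hH hD hLieTresse hz⟩
  · exact CondLin.totalDerivAlong_totalDerivAlong_rootRHS hU hC hG hH hD hz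
      (CondLin.coeff_seven_eq P z) (CondLin.coeff_six_eq (hc z hz))
      (CondLin.coeff_five_eq (hc z hz)) (CondLin.coeff_four_eq (hc z hz)) (hconstraints z hz) p
  · refine CondLin.not_isTotalDerivativeOn_septic hV hz ?_
    rw [CondLin.coeff_seven_eq P z]
    exact mul_ne_zero (by norm_num) (pow_ne_zero 3 (hc z (hVU hz)))
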